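/- \textbf{Theorem.} Write $[m]=\{0,\dots,m-1\}$, $\lg=\log_2$ and $\mathcal B(n,m)=\lceil\lg\binom mn\rceil$. For a finite set $S\subseteq\mathbb N$ and $1\le i\le|S|$ let $\mathrm{Select}(i,S)$ be the $i$-th smallest element of $S$. Every set $S\subseteq[m]$ of size $n$ can be represented by at most $\mathcal B(n,m)+o(n)$ bits so that $\mathrm{Select}$ is supported in constant time on a word RAM whose words have at least $\lg m$ bits. In detail: there are a single word-RAM program $P$, a constant $T$ and a function $f:\mathbb N\to\mathbb N$ with $f(n)=o(n)$ such that for all natural numbers $w,n,m$ with $m\le 2^w$ and every $S\subseteq[m]$ with $|S|=n$ there is a bit string $D$ of length at most $\mathcal B(n,m)+f(n)$ with the following property: for every $i\in\{1,\dots,n\}$, the program $P$, run on the machine of word size $w$ whose read-only memory holds $D$ packed into consecutive $w$-bit words (the bits behind the end of $D$ are $0$) and whose first four registers initially hold $i,n,m,w$ (modulo $2^w$; all other registers hold $0$), halts after at most $T$ steps with $\mathrm{Select}(i,S)$ in register $0$. The machine's unit-cost instructions on $w$-bit words are: loading a constant; addition, subtraction and multiplication modulo $2^w$; integer division and remainder;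 bitwise and, or, exclusive or; left and right shift; $x\mapsto\lfloor\lg x\rfloor$ (with $0\mapsto0$); reading the memory word at the address held in a register; and jumps conditional on $<$ or $=$ between two registers. -/

import Mathlib

/-! The word RAM.  A machine of word size `w` has registers `R[0], R[1], …` that hold `w`-bit
words, and it can read (not write) the memory cells in which the data structure is stored. -/

namespace WordRAM

/-- The two-operand instructions.  Arithmetic is unsigned and modulo `2 ^ w`; a shift by `w` or
more positions gives `0`. -/
inductive BinOp : Type
  | add | sub | mul | div | mod | and | or | xor | shl | shr

/-- The value of a two-operand instruction on `w`-bit words. -/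
def BinOp.eval {w : ℕ} : BinOp → BitVec w → BitVec w → BitVec w
  | add, x, y => x + y
  | sub, x, y => x - y
  | mul, x, y => x * y
  | div, x, y => x / y
  | mod, x, y => x % y
  | and, x, y => x &&& y
  | or, x, y => x ||| y
  | xor, x, y => x ^^^ y
  | shl, x, y => x <<< y
  | shr, x, y => x >>> y

/-- The instructions.  The numbers `d`, `a`, `b` are register numbers, `c` is a constant and `t`
is a position in the program. -/
inductive Instr : Type
  /-- `R[d] := c` (modulo `2 ^ w`) -/
  | const (d c : ℕ)
  /-- `R[d] := R[a] o R[b]` -/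
  | op (o : BinOp) (d a b : ℕ)
  /-- `R[d] := ⌊lg R[a]⌋`, the position of the most significant bit (`0` if `R[a] = 0`) -/
  | msb (d a : ℕ)
  /-- `R[d] := M[R[a]]`, where `M` is the memory -/
  | load (d a : ℕ)
  /-- go to `t` if `R[a] < R[b]` -/
  | jlt (a b t : ℕ)
  /-- go to `t` if `R[a] = R[b]` -/
  | jeq (a b t : ℕ)

/-- A program is a finite list of instructions.  It does not depend on the word size. -/
abbrev Program : Type := List Instr

/-- A configuration: the program counter and the contents of the registers. -/
structure Config (w : ℕ) : Type where
  pc : ℕ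
  reg : ℕ → BitVec w

/-- Write `v` to register `d` and proceed to the next instruction. -/
def Config.write {w : ℕ} (C : Config w) (d : ℕ) (v : BitVec w) : Config w :=
  { pc := C.pc + 1, reg := Function.update C.reg d v }

/-- Go to `t` if `p` holds, and to the next instruction otherwise. -/
def Config.jump {w : ℕ} (C : Config w) (p : Bool) (t : ℕ) : Config w :=
  { pc := if p then t else C.pc + 1, reg := C.reg }

/-- The effect of one instruction, with memory contents `M`. -/
def Instr.exec {w : ℕ} (M : BitVec w → BitVec w) (C : Config w) : Instr → Config w
  | const d c => C.write d (BitVec.ofNat w c)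
  | op o d a b => C.write d (o.eval (C.reg a) (C.reg b))
  | msb d a => C.write d (BitVec.ofNat w (Nat.log 2 (C.reg a).toNat))
  | load d a => C.write d (M (C.reg a))
  | jlt a b t => C.jump (decide ((C.reg a).toNat < (C.reg b).toNat)) t
  | jeq a b t => C.jump (decide (C.reg a = C.reg b)) t

/-- The machine has halted when the program counter has left the program. -/
def Halted {w : ℕ} (P : Program) (C : Config w) : Prop := P.length ≤ C.pc

/-- One step of the program `P`: execute the instruction at the program counter.
A halted machine stays as it is. -/
def step {w : ℕ} (P : Program) (M : BitVec w → BitVec w) (C : Config w) : Config w :=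
  match P[C.pc]? with
  | some I => I.exec M C
  | none => C

/-- Started with memory `M` and registers `R`, the program `P` halts after at most `T` steps,
with the number `x` in register `0`. -/
def ComputesIn {w : ℕ} (P : Program) (M : BitVec w → BitVec w) (R : ℕ → BitVec w)
    (T x : ℕ) : Prop :=
  let C := (step P M)^[T] { pc := 0, reg := R }
  Halted P C ∧ (C.reg 0).toNat = x

/-- The memory that holds the bit string `D`: its bits are packed into consecutive words of `w`
bits each, from address `0` on (bit `j` of word `a` is bit `a * w + j` of `D`), and all bits
behind the end of `D` are `0`. -/
def memory (w : ℕ) (D : List Bool) (a : BitVec w) : BitVec w :=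
  BitVec.ofFnLE fun j : Fin w => D.getD (a.toNat * w + j) false

/-- The initial registers of a query: `R[0] = i` is the argument of the query, `R[1] = n` and
`R[2] = m` are the size of the set and of the universe, `R[3] = w` is the word size, and the other
registers are `0`.  (Numbers are stored modulo `2 ^ w`; as `1 ≤ i ≤ n ≤ m ≤ 2 ^ w` in every query,
each of them is determined by its word.) -/
def queryRegs (w i n m : ℕ) : ℕ → BitVec w
  | 0 => BitVec.ofNat w i
  | 1 => BitVec.ofNat w n
  | 2 => BitVec.ofNat w m
  | 3 => BitVec.ofNat w w
  | _ => 0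

end WordRAM

/-- `ℬ(n, m) = ⌈lg (m choose n)⌉`, the information-theoretic minimum number of bits for storing an
`n`-element subset of `{0, …, m - 1}`. -/
noncomputable def setBits (n m : ℕ) : ℕ := ⌈Real.logb 2 (m.choose n : ℝ)⌉₊

/-- `Select(i, S)`, the `i`-th smallest element of `S`, for `1 ≤ i ≤ |S|`. -/
noncomputable def selectElem (S : Finset ℕ) (i : ℕ) : ℕ := Nat.nth (fun x => x ∈ S) (i - 1)

/-! Put L = ⌊lg n⌋ and e = ⌊lg L⌋, so that n ≥ 2^(2^e). Each element is split into about lg (m / (n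
e)) low bits, kept in a plain array, and a high part. Adding the index to the high parts makes them
strictly increasing, and they stay below 4ne. The high universe has size at least ne whenever there
are low bits, so the split loses only O(1/e) bits per element (`choose_mul_pow_le`); without low
bits nothing is split.

The increasing sequence z of high parts is cut into blocks of e² elements. A block is stored as its
index among all sets of that size within its span (`exists_decoder`). By Vandermonde the product of
the binomials of the blocks is at most the binomial of the whole (`prod_choose_le_choose`), so these
codes exceed the optimum only by the rounding, one bit per block.

To find and decode a block, 2^(2e) blocks form a superblock. Superblocks that span 2^(4e) numbers or
more are rare, and their elements are written out. In the others every local quantity fits into 4e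
bits, so a directory entry per block costs O(e) bits, which is O(n/e) in all. A block code has at
most 4e³ bits and is decoded by a table of 2^O(e³) bits, negligible against n. `exists_layout`
builds the bit string, and `Scale.total_le` bounds its length by ℬ(n, m) + 50n/e.

A query is a constant number of field reads (`val_lookupCode`). The program is loop-free, so its
running time is at most its length (`Code.code_spec`). Bit positions may exceed 2^w although word
addresses do not; a field is therefore read without forming its position (`Exp.val_read`).

Only finitely many n have e < 128. A plain array serves them, since the redundancy is unrestricted
there. For n = m nothing is stored. -/

namespace WordRAM

/-! ### Compiling expressions and loop-free programs to machine code -/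

/-- The value of a two-operand instruction on numbers below `2 ^ w`. -/
def BinOp.natEval (w : ℕ) : BinOp → ℕ → ℕ → ℕ
  | add, x, y => (x + y) % 2 ^ w
  | sub, x, y => (2 ^ w - y + x) % 2 ^ w
  | mul, x, y => (x * y) % 2 ^ w
  | div, x, y => x / y
  | mod, x, y => x % y
  | and, x, y => x &&& y
  | or, x, y => x ||| y
  | xor, x, y => x ^^^ y
  | shl, x, y => (x <<< y) % 2 ^ w
  | shr, x, y => x >>> y

theorem BinOp.toNat_eval {w : ℕ} (o : BinOp) (x y : BitVec w) :
    (o.eval x y).toNat = o.natEval w x.toNat y.toNat := by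
  cases o <;> simp [BinOp.eval, BinOp.natEval]

/-- Expressions over the registers and the memory. -/
inductive Exp : Type
  | var (r : ℕ)
  | lit (c : ℕ)
  | bin (o : BinOp) (a b : Exp)
  | msb (a : Exp)
  | load (a : Exp)

namespace Exp

/-- The value of an expression in the environment that lists the contents of the registers. -/
def val (w : ℕ) (M : ℕ → ℕ) (env : List ℕ) : Exp → ℕ
  | var r => env.getD r 0
  | lit c => c % 2 ^ w
  | bin o a b => o.natEval w (a.val w M env) (b.val w M env)
  | msb a => Nat.log 2 (a.val w M env) % 2 ^ w
  | load a => M (a.val w M env)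

/-- The expression reads only registers below `d`. -/
def Below (d : ℕ) : Exp → Bool
  | var r => decide (r < d)
  | lit _ => true
  | bin _ a b => a.Below d && b.Below d
  | msb a => a.Below d
  | load a => a.Below d

/-- Code that evaluates an expression into register `d`, using only registers from `d` on. -/
def code (d : ℕ) : Exp → List Instr
  | var r => [Instr.op .or d r r]
  | lit c => [.const d c]
  | bin o a b => a.code d ++ b.code (d + 1) ++ [Instr.op o d d (d + 1)]
  | msb a => a.code d ++ [Instr.msb d d]
  | load a => a.code d ++ [.load d d]

end Exp

/-- The registers below `d` hold the first `d` entries of the environment. -/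
def Agrees {w : ℕ} (R : ℕ → BitVec w) (env : List ℕ) (d : ℕ) : Prop :=
  ∀ r < d, (R r).toNat = env.getD r 0

theorem step_append {w : ℕ} (M : BitVec w → BitVec w) (pre post : Program) (I : Instr)
    (R : ℕ → BitVec w) :
    step (pre ++ I :: post) M ⟨pre.length, R⟩ = I.exec M ⟨pre.length, R⟩ := by
  simp [step]

/-- The induction needs arbitrary surrounding code and an arbitrary target register d. The first
operand's value in d survives the second evaluation because that one writes only from d + 1 on. -/
theorem Exp.code_spec {w : ℕ} {M : BitVec w → BitVec w} {Mn : ℕ → ℕ}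
    (hM : ∀ a, (M a).toNat = Mn a.toNat) (env : List ℕ) (e : Exp) :
    ∀ (d : ℕ) (pre post : Program) (R : ℕ → BitVec w), e.Below env.length → env.length ≤ d →
      Agrees R env env.length →
      ∃ R' : ℕ → BitVec w,
        (step (pre ++ e.code d ++ post) M)^[(e.code d).length] ⟨pre.length, R⟩
          = ⟨pre.length + (e.code d).length, R'⟩ ∧
        (R' d).toNat = e.val w Mn env ∧ ∀ r < d, R' r = R r := by
  induction e with
  | var r =>
    intro d pre post R hb hd hR
    refine ⟨Function.update R d (R r ||| R r), ?_, ?_, ?_⟩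
    · simp [code, step_append, Instr.exec, Config.write, BinOp.eval]
    · simp only [Below, decide_eq_true_eq] at hb
      simpa [val] using hR r hb
    · intro r hr; simp [hr.ne]
  | lit c =>
    intro d pre post R _ _ _
    refine ⟨Function.update R d (BitVec.ofNat w c), ?_, ?_, ?_⟩
    · simp [code, step_append, Instr.exec, Config.write]
    · simp [val]
    · intro r hr; simp [hr.ne]
  | bin o a b iha ihb =>
    intro d pre post R hb hd hR
    simp only [Below, Bool.and_eq_true] at hb
    obtain ⟨R₁, h1, v1, r1⟩ := iha d pre (b.code (d + 1) ++ [Instr.op o d d (d + 1)] ++ post) R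
      hb.1 hd hR
    obtain ⟨R₂, h2, v2, r2⟩ := ihb (d + 1) (pre ++ a.code d) ([Instr.op o d d (d + 1)] ++ post) R₁
      hb.2 (by omega) (fun r hr => by rw [r1 r (by omega)]; exact hR r hr)
    refine ⟨Function.update R₂ d (o.eval (R₂ d) (R₂ (d + 1))), ?_, ?_, ?_⟩
    · have hlen : ((Exp.bin o a b).code d).length
          = 1 + ((b.code (d + 1)).length + (a.code d).length) := by
        simp [code]; omega
      have e1 : pre ++ (Exp.bin o a b).code d ++ post
          = pre ++ a.code d ++ (b.code (d + 1) ++ [Instr.op o d d (d + 1)] ++ post) := by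
        simp [code]
      have e2 : pre ++ (Exp.bin o a b).code d ++ post
          = pre ++ a.code d ++ b.code (d + 1) ++ ([Instr.op o d d (d + 1)] ++ post) := by
        simp [code]
      rw [hlen, Function.iterate_add_apply, Function.iterate_add_apply, e1, h1, ← e1, e2,
        ← List.length_append, h2, ← List.length_append]
      simp only [Function.iterate_one, List.singleton_append, step_append]
      simp [Instr.exec, Config.write]
      omega
    · simp [val, BinOp.toNat_eval, v2, r2 d (by omega), v1]
    · intro r hr
      simp [hr.ne, r2 r (by omega), r1 r hr]
  | msb a iha =>
    intro d pre post R hb hd hR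
    obtain ⟨R₁, h1, v1, r1⟩ := iha d pre ([.msb d d] ++ post) R hb hd hR
    refine ⟨Function.update R₁ d (BitVec.ofNat w (Nat.log 2 (R₁ d).toNat)), ?_, ?_, ?_⟩
    · have hlen : ((Exp.msb a).code d).length = 1 + (a.code d).length := by
        simp [code]; omega
      have e1 : pre ++ (Exp.msb a).code d ++ post = pre ++ a.code d ++ ([.msb d d] ++ post) := by
        simp [code]
      rw [hlen, Function.iterate_add_apply, e1, h1, ← List.length_append]
      simp only [Function.iterate_one, List.singleton_append, step_append]
      simp [Instr.exec, Config.write]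
      omega
    · simp [val, v1]
    · intro r hr
      simp [hr.ne, r1 r hr]
  | load a iha =>
    intro d pre post R hb hd hR
    obtain ⟨R₁, h1, v1, r1⟩ := iha d pre ([.load d d] ++ post) R hb hd hR
    refine ⟨Function.update R₁ d (M (R₁ d)), ?_, ?_, ?_⟩
    · have hlen : ((Exp.load a).code d).length = 1 + (a.code d).length := by
        simp [code]; omega
      have e1 : pre ++ (Exp.load a).code d ++ post = pre ++ a.code d ++ ([.load d d] ++ post) := by
        simp [code]
      rw [hlen, Function.iterate_add_apply, e1, h1, ← List.length_append]
      simp only [Function.iterate_one, List.singleton_append, step_append]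
      simp [Instr.exec, Config.write]
      omega
    · simp [val, v1, hM]
    · intro r hr
      simp [hr.ne, r1 r hr]

/-- Loop-free programs: a `bind` stores the value of an expression in the next free register. -/
inductive Code : Type
  | ret (e : Exp)
  | bind (e : Exp) (k : Code)
  | ite (a b : Exp) (p q : Code)

namespace Code

/-- The result of a loop-free program. -/
def val (w : ℕ) (M : ℕ → ℕ) : List ℕ → Code → ℕ
  | env, ret e => e.val w M env
  | env, bind e k => k.val w M (env ++ [e.val w M env])
  | env, ite a b p q =>
      if a.val w M env < b.val w M env then p.val w M env else q.val w M env

/-- The program reads only registers below `d`, or registers that it has written. -/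
def Below (d : ℕ) : Code → Bool
  | ret e => e.Below d
  | bind e k => e.Below d && k.Below (d + 1)
  | ite a b p q => a.Below d && (b.Below d && (p.Below d && q.Below d))

/-- Compilation to machine code that starts at position `s` and ends with a jump to `H`. -/
def code (H : ℕ) : ℕ → ℕ → Code → Program
  | d, _, ret e => e.code d ++ [Instr.op .or 0 d d, Instr.jeq 0 0 H]
  | d, s, bind e k => e.code d ++ k.code H (d + 1) (s + (e.code d).length)
  | d, s, ite a b p q =>
      let c := a.code d ++ b.code (d + 1)
      -- The else branch directly follows the test. Neither branch falls through, as every path ends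
      -- with the jump to `H`.
      let f := q.code H d (s + c.length + 1)
      let t := s + c.length + 1 + f.length
      c ++ [Instr.jlt d (d + 1) t] ++ f ++ p.code H d t

/-- All jumps go forward, so a run executes each instruction at most once; hence the bound on `T`.
-/
theorem code_spec {w : ℕ} {M : BitVec w → BitVec w} {Mn : ℕ → ℕ} {H : ℕ}
    (hM : ∀ a, (M a).toNat = Mn a.toNat) (c : Code) :
    ∀ (env : List ℕ) (pre post : Program) (R : ℕ → BitVec w), c.Below env.length →
      Agrees R env env.length →
      ∃ (T : ℕ) (C : Config w), T ≤ (c.code H env.length pre.length).length ∧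
        (step (pre ++ c.code H env.length pre.length ++ post) M)^[T] ⟨pre.length, R⟩ = C ∧
        C.pc = H ∧ (C.reg 0).toNat = c.val w Mn env := by
  induction c with
  | ret e =>
    intro env pre post R hb hR
    obtain ⟨R₁, h1, v1, r1⟩ := e.code_spec hM env env.length pre
      ([Instr.op .or 0 env.length env.length, Instr.jeq 0 0 H] ++ post) R hb le_rfl hR
    refine ⟨(1 + 1) + (e.code env.length).length,
      ⟨H, Function.update R₁ 0 (R₁ env.length ||| R₁ env.length)⟩, ?_, ?_, rfl, ?_⟩
    · simp [code]; omega
    · have e1 : pre ++ (ret e).code H env.length pre.length ++ post = pre ++ e.code env.length ++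
          ([Instr.op .or 0 env.length env.length, Instr.jeq 0 0 H] ++ post) := by simp [code]
      have e2 : pre ++ (ret e).code H env.length pre.length ++ post =
          (pre ++ e.code env.length ++ [Instr.op .or 0 env.length env.length]) ++
          (Instr.jeq 0 0 H :: post) := by simp [code]
      rw [Function.iterate_add_apply, e1, h1, ← List.length_append, Function.iterate_add_apply]
      simp only [Function.iterate_one]
      rw [show ([Instr.op .or 0 env.length env.length, Instr.jeq 0 0 H] ++ post : Program) =
        Instr.op .or 0 env.length env.length :: (Instr.jeq 0 0 H :: post) from rfl, step_append]
      have e3 : (Instr.exec M ⟨(pre ++ e.code env.length).length, R₁⟩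
          (Instr.op .or 0 env.length env.length)) =
          ⟨(pre ++ e.code env.length ++ [Instr.op .or 0 env.length env.length]).length,
            Function.update R₁ 0 (R₁ env.length ||| R₁ env.length)⟩ := by
        simp [Instr.exec, Config.write, BinOp.eval]; omega
      rw [e3]
      have e4 : pre ++ e.code env.length ++
          (Instr.op .or 0 env.length env.length :: (Instr.jeq 0 0 H :: post)) =
          (pre ++ e.code env.length ++ [Instr.op .or 0 env.length env.length]) ++
          (Instr.jeq 0 0 H :: post) := by simp
      rw [e4, step_append]
      simp [Instr.exec, Config.jump]
    · simpa [val] using v1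
  | bind e k ih =>
    intro env pre post R hb hR
    simp only [Below, Bool.and_eq_true] at hb
    obtain ⟨R₁, h1, v1, r1⟩ := e.code_spec hM env env.length pre
      (k.code H (env.length + 1) (pre.length + (e.code env.length).length) ++ post) R hb.1 le_rfl hR
    obtain ⟨T, C, hT, hC, hpc, hv⟩ := ih (env ++ [e.val w Mn env]) (pre ++ e.code env.length) post
      R₁ (by simpa using hb.2) (by
        intro r hr
        simp only [List.length_append, List.length_singleton] at hr
        rcases Nat.lt_succ_iff_lt_or_eq.1 hr with h | h
        · rw [r1 r h, hR r h, List.getD_append _ _ _ _ h]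
        · subst h; rw [v1]; simp)
    have e1 : pre ++ (bind e k).code H env.length pre.length ++ post = pre ++ e.code env.length ++
        (k.code H (env.length + 1) (pre.length + (e.code env.length).length) ++ post) := by
      simp [code]
    simp only [List.length_append, List.length_singleton] at hT hC
    refine ⟨T + (e.code env.length).length, C, ?_, ?_, hpc, hv⟩
    · simp [code]; omega
    · rw [Function.iterate_add_apply, e1, h1, ← hC, List.append_assoc _ _ post]
  | ite a b p q ihp ihq =>
    intro env pre post R hb hR
    simp only [Below, Bool.and_eq_true] at hb
    obtain ⟨ha, hb, hp, hq⟩ := hb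
    set d := env.length with hd
    set ca := a.code d with hca
    set cb := b.code (d + 1) with hcb
    set f := q.code H d (pre.length + (ca ++ cb).length + 1) with hf
    set t := pre.length + (ca ++ cb).length + 1 + f.length with ht
    set g := p.code H d t with hg
    have hcode : (ite a b p q).code H d pre.length
        = ca ++ cb ++ [Instr.jlt d (d + 1) t] ++ f ++ g := rfl
    rw [hcode]
    obtain ⟨R₁, h1, v1, r1⟩ := a.code_spec hM env d pre
      (cb ++ [Instr.jlt d (d + 1) t] ++ f ++ g ++ post) R ha le_rfl hR
    obtain ⟨R₂, h2, v2, r2⟩ := b.code_spec hM env (d + 1) (pre ++ ca)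
      ([Instr.jlt d (d + 1) t] ++ f ++ g ++ post) R₁ hb (by omega)
      (fun r hr => by rw [r1 r hr]; exact hR r hr)
    have hR2 : Agrees R₂ env d := fun r hr => by
      rw [r2 r (by omega), r1 r hr]; exact hR r hr
    rw [← hca] at h1
    rw [← hcb] at h2
    have e1 : pre ++ (ca ++ cb ++ [Instr.jlt d (d + 1) t] ++ f ++ g) ++ post =
        pre ++ ca ++ (cb ++ [Instr.jlt d (d + 1) t] ++ f ++ g ++ post) := by simp
    have e2 : pre ++ (ca ++ cb ++ [Instr.jlt d (d + 1) t] ++ f ++ g) ++ post =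
        pre ++ ca ++ cb ++ ([Instr.jlt d (d + 1) t] ++ f ++ g ++ post) := by simp
    have e3 : pre ++ (ca ++ cb ++ [Instr.jlt d (d + 1) t] ++ f ++ g) ++ post =
        (pre ++ ca ++ cb) ++ (Instr.jlt d (d + 1) t :: (f ++ g ++ post)) := by simp
    have e4 : pre ++ (ca ++ cb ++ [Instr.jlt d (d + 1) t] ++ f ++ g) ++ post =
        (pre ++ ca ++ cb ++ [Instr.jlt d (d + 1) t]) ++ f ++ (g ++ post) := by simp
    have e5 : pre ++ (ca ++ cb ++ [Instr.jlt d (d + 1) t] ++ f ++ g) ++ post =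
        (pre ++ ca ++ cb ++ [Instr.jlt d (d + 1) t] ++ f) ++ g ++ post := by simp
    rw [← e1] at h1
    rw [← e2] at h2
    have hlen : (pre ++ ca ++ cb).length = (pre ++ ca).length + cb.length := by simp; omega
    have hrun : (step (pre ++ (ca ++ cb ++ [Instr.jlt d (d + 1) t] ++ f ++ g) ++ post) M)^[
        1 + (cb.length + ca.length)] ⟨pre.length, R⟩ =
        ⟨if a.val w Mn env < b.val w Mn env then t
          else (pre ++ ca ++ cb).length + 1, R₂⟩ := by
      rw [Function.iterate_add_apply, Function.iterate_add_apply, h1, ← List.length_append, h2,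
        ← hlen, Function.iterate_one, e3, step_append]
      have := r2 d (by omega)
      simp [Instr.exec, Config.jump, this, v1, v2]
    by_cases hlt : a.val w Mn env < b.val w Mn env
    · rw [if_pos hlt] at hrun
      have hlen5 : (pre ++ ca ++ cb ++ [Instr.jlt d (d + 1) t] ++ f).length = t := by
        rw [ht]; simp; omega
      obtain ⟨T, C, hT, hC, hpc, hv⟩ := ihp env
        (pre ++ ca ++ cb ++ [Instr.jlt d (d + 1) t] ++ f) post R₂ hp hR2
      rw [hlen5, ← hd, ← hg] at hT hC
      refine ⟨T + (1 + (cb.length + ca.length)), C, ?_, ?_, hpc, ?_⟩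
      · simp; omega
      · rw [Function.iterate_add_apply, hrun, e5, hC]
      · rw [hv, val, if_pos hlt]
    · rw [if_neg hlt] at hrun
      have hlen4 : (pre ++ ca ++ cb ++ [Instr.jlt d (d + 1) t]).length
          = pre.length + (ca ++ cb).length + 1 := by
        simp; omega
      obtain ⟨T, C, hT, hC, hpc, hv⟩ := ihq env
        (pre ++ ca ++ cb ++ [Instr.jlt d (d + 1) t]) (g ++ post) R₂ hq hR2
      rw [hlen4, ← hd, ← hf] at hT hC
      refine ⟨T + (1 + (cb.length + ca.length)), C, ?_, ?_, hpc, ?_⟩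
      · simp; omega
      · rw [Function.iterate_add_apply, hrun, e4, ← hC]
        congr 2
        simp
      · rw [hv, val, if_neg hlt]

end Code

theorem iterate_step_of_halted {w : ℕ} {P : Program} {M : BitVec w → BitVec w} {C : Config w}
    (h : Halted P C) (k : ℕ) : (step P M)^[k] C = C := by
  have : step P M C = C := by
    have : P[C.pc]? = none := List.getElem?_eq_none h
    simp [step, this]
  exact Function.iterate_fixed this k

/-- A run may reach `H` before the program length is used up; since `H` lies outside the program,
the remaining steps do nothing. -/
theorem Code.computesIn {w : ℕ} {M : BitVec w → BitVec w} {Mn : ℕ → ℕ} {c : Code} {H : ℕ}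
    {env : List ℕ} {R : ℕ → BitVec w}
    (hM : ∀ a, (M a).toNat = Mn a.toNat) (hc : c.Below env.length) (hR : Agrees R env env.length)
    (hH : (c.code H env.length 0).length ≤ H) :
    ComputesIn (c.code H env.length 0) M R (c.code H env.length 0).length (c.val w Mn env) := by
  obtain ⟨T, C, hT, hC, hpc, hv⟩ := c.code_spec (H := H) hM env [] [] R hc hR
  simp only [List.length_nil, List.nil_append, List.append_nil] at hT hC
  have hh : Halted (c.code H env.length 0) C := by rw [Halted, hpc]; exact hH
  obtain ⟨k, hk⟩ := Nat.exists_eq_add_of_le' hT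
  have hfin : (step (c.code H env.length 0) M)^[(c.code H env.length 0).length]
      { pc := 0, reg := R } = C := by
    rw [hk, Function.iterate_add_apply, hC, iterate_step_of_halted hh]
  rw [ComputesIn, hfin]
  exact ⟨hh, hv⟩

end WordRAM

/-! ### Bit strings as numbers -/

/-- Concatenation of bit fields: field `i` holds `v i` and starts at bit `P i`. -/
def packBits (P v : ℕ → ℕ) : ℕ → ℕ
  | 0 => 0
  | n + 1 => packBits P v n + v n * 2 ^ P n

theorem packBits_lt {P v : ℕ → ℕ} {n : ℕ} (hP : ∀ i < n, P i ≤ P (i + 1))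
    (hv : ∀ i < n, v i < 2 ^ (P (i + 1) - P i)) : packBits P v n < 2 ^ P n := by
  induction n with
  | zero => simp [packBits]
  | succ n ih =>
    have h1 := ih (fun i hi => hP i (by omega)) (fun i hi => hv i (by omega))
    have h2 := hv n (by omega)
    have h3 : 2 ^ P (n + 1) = 2 ^ (P (n + 1) - P n) * 2 ^ P n := by
      rw [← pow_add]; congr 1; have := hP n (by omega); omega
    rw [packBits, h3]
    calc packBits P v n + v n * 2 ^ P n < 2 ^ P n + v n * 2 ^ P n := by omega
      _ = (v n + 1) * 2 ^ P n := by ring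
      _ ≤ _ := Nat.mul_le_mul_right _ h2

/-- Fields after field i contribute multiples of 2^P(i+1), which the remainder removes; fields
before it sum to less than 2^P(i), which the quotient removes. -/
theorem packBits_read {P v : ℕ → ℕ} {n : ℕ} (hP : ∀ i < n, P i ≤ P (i + 1))
    (hv : ∀ i < n, v i < 2 ^ (P (i + 1) - P i)) {i : ℕ} (hi : i < n) :
    packBits P v n / 2 ^ P i % 2 ^ (P (i + 1) - P i) = v i := by
  induction n with
  | zero => omega
  | succ n ih =>
    rw [packBits]
    rcases Nat.lt_succ_iff_lt_or_eq.1 hi with h | h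
    · have hle : P (i + 1) ≤ P n := by
        have : ∀ j, i + 1 ≤ j → j ≤ n → P (i + 1) ≤ P j := by
          intro j hj
          induction j, hj using Nat.le_induction with
          | base => intro _; exact le_rfl
          | succ j hj ih2 => intro hjn; exact (ih2 (by omega)).trans (hP j (by omega))
        exact this n h le_rfl
      have h0 := hP i (by omega)
      have h3 : 2 ^ P n = 2 ^ (P n - P (i + 1)) * 2 ^ (P (i + 1) - P i) * 2 ^ P i := by
        rw [← pow_add, ← pow_add]; congr 1; omega
      rw [h3, ← mul_assoc, ← mul_assoc, Nat.add_mul_div_right _ _ (by positivity),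
        Nat.add_mul_mod_self_right]
      exact ih (fun i hi => hP i (by omega)) (fun i hi => hv i (by omega)) h
    · subst h
      have h1 := packBits_lt (fun j hj => hP j (by omega)) (fun j hj => hv j (by omega)) (n := i)
      rw [Nat.add_mul_div_right _ _ (by positivity), Nat.div_eq_of_lt h1, zero_add,
        Nat.mod_eq_of_lt (hv i hi)]

/-- Reading a part of a field. -/
theorem div_mod_of_read {X p l v q l' : ℕ} (h : X / 2 ^ p % 2 ^ l = v) (hq : q + l' ≤ l) :
    X / 2 ^ (p + q) % 2 ^ l' = v / 2 ^ q % 2 ^ l' := by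
  subst h
  apply Nat.eq_of_testBit_eq
  intro i
  simp only [Nat.testBit_mod_two_pow, Nat.testBit_div_two_pow]
  by_cases hi : i < l'
  · simp only [hi, decide_true, Bool.true_and]
    rw [show i + q < l by omega |> fun h => (decide_eq_true h : decide (i + q < l) = true)]
    simp [add_comm, add_left_comm]
  · simp [hi]

theorem packBits_fixed_lt {g : ℕ} {v : ℕ → ℕ} {n : ℕ} (hv : ∀ i < n, v i < 2 ^ g) :
    packBits (fun i => g * i) v n < 2 ^ (g * n) :=
  packBits_lt (P := fun i => g * i) (fun i _ => Nat.mul_le_mul_left _ (by omega))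
    (fun i hi => by simpa [Nat.mul_add] using hv i hi)

theorem packBits_fixed_read {g : ℕ} {v : ℕ → ℕ} {n : ℕ} (hv : ∀ i < n, v i < 2 ^ g) {i : ℕ}
    (hi : i < n) : packBits (fun i => g * i) v n / 2 ^ (g * i) % 2 ^ g = v i := by
  have := packBits_read (P := fun i => g * i) (fun i _ => Nat.mul_le_mul_left _ (by omega))
    (fun i hi => by simpa [Nat.mul_add] using hv i hi) hi
  simpa [Nat.mul_add] using this

/-- The first `l` bits of a number. -/
def bitList (X l : ℕ) : List Bool := List.ofFn fun j : Fin l => X.testBit j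

@[simp] theorem length_bitList (X l : ℕ) : (bitList X l).length = l := by simp [bitList]

theorem getD_bitList {X l : ℕ} (hX : X < 2 ^ l) (j : ℕ) :
    (bitList X l).getD j false = X.testBit j := by
  by_cases hj : j < l
  · simp [bitList, List.getD, hj]
  · have : X.testBit j = false :=
      Nat.testBit_lt_two_pow (hX.trans_le (Nat.pow_le_pow_right (by norm_num) (by omega)))
    simp [bitList, List.getD, hj, this]

/-! ### Reading a bit field that may cross a word boundary -/

namespace WordRAM

theorem toNat_memory {w X l : ℕ} (hX : X < 2 ^ l) (a : BitVec w) :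
    (memory w (bitList X l) a).toNat = X / 2 ^ (a.toNat * w) % 2 ^ w := by
  rw [memory, BitVec.toNat_ofFnLE]
  apply Nat.eq_of_testBit_eq
  intro i
  simp only [Nat.testBit_mod_two_pow, Nat.testBit_div_two_pow]
  by_cases hi : i < w
  · rw [Nat.testBit_ofBits_lt _ _ hi, getD_bitList hX]
    simp [hi, add_comm]
  · rw [Nat.testBit_ofBits_ge _ _ (by omega)]
    simp [hi]

/-- For r = 0 the second word is shifted by w places and vanishes, so an aligned field needs no case
distinction. -/
theorem two_word_read (X w A r : ℕ) (hr : r < w) :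
    ((X / 2 ^ (A * w) % 2 ^ w) >>> r) ||| (((X / 2 ^ ((A + 1) * w) % 2 ^ w) <<< (w - r)) % 2 ^ w)
      = X / 2 ^ (A * w + r) % 2 ^ w := by
  apply Nat.eq_of_testBit_eq
  intro i
  simp only [Nat.testBit_mod_two_pow, Nat.testBit_div_two_pow, Nat.testBit_or,
    Nat.testBit_shiftRight, Nat.testBit_shiftLeft]
  by_cases hi : i < w
  · by_cases h2 : r + i < w
    · have : ¬ (i ≥ w - r) := by omega
      simp [hi, h2, this]
      congr 1; ring
    · have h3 : i ≥ w - r := by omega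
      have h4 : i - (w - r) < w := by omega
      simp only [hi, h2, h3, h4]
      simp
      congr 1
      have : (A + 1) * w = A * w + w := by ring
      omega
  · have : ¬ (r + i < w) := by omega
    simp [hi, this]

namespace Exp

/-- An expression for the `l` bits from bit `a + u * g + r` of the memory on; register `3` holds the
word size.  The position itself need not fit into a word. -/
def read (a u g r l : Exp) : Exp :=
  let W := var 3
  let s := bin .add (bin .add (bin .mul (bin .mod u W) g) (bin .mod a W)) r
  let q := bin .add (bin .add (bin .div a W) (bin .mul (bin .div u W) g)) (bin .div s W)
  let o := bin .mod s W
  bin .and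
    (bin .or (bin .shr (load q) o) (bin .shl (load (bin .add q (lit 1))) (bin .sub W o)))
    (bin .sub (bin .shl (lit 1) l) (lit 1))

/-- If l ≥ w, the shifted 1 vanishes and subtracting 1 wraps around to the all-ones word. Fields
wider than a word are thus read modulo 2^w. -/
theorem mask_eq {w l : ℕ} (hw : 0 < w) :
    (2 ^ w - 1 + (1 <<< l) % 2 ^ w) % 2 ^ w = 2 ^ min l w - 1 := by
  have h1 : 1 < 2 ^ w := Nat.one_lt_two_pow hw.ne'
  rw [Nat.shiftLeft_eq, one_mul]
  by_cases h : l < w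
  · have h2 : 2 ^ l < 2 ^ w := Nat.pow_lt_pow_right (by norm_num) h
    have h3 : 0 < 2 ^ l := by positivity
    rw [Nat.mod_eq_of_lt h2, min_eq_left h.le,
      show 2 ^ w - 1 + 2 ^ l = 2 ^ l - 1 + 2 ^ w by omega, Nat.add_mod_right,
      Nat.mod_eq_of_lt (by omega)]
  · have : 2 ^ l % 2 ^ w = 0 :=
      Nat.mod_eq_zero_of_dvd (Nat.pow_dvd_pow 2 (by omega))
    rw [this, min_eq_right (by omega), add_zero, Nat.mod_eq_of_lt (by omega)]

/-- Writing a and u as quotient and remainder by w, the quotients contribute whole words and only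
the remainders enter the bit offset s. The word address and s must fit into a word (`h2`, `h1`), but
the bit position need not. -/
theorem val_read {w : ℕ} {M : ℕ → ℕ} {env : List ℕ} {a u g r l : Exp} {X a' u' g' r' l' : ℕ}
    (hw : 0 < w) (hW : env.getD 3 0 = w) (hM : ∀ b < 2 ^ w, M b = X / 2 ^ (b * w) % 2 ^ w)
    (ha : a.val w M env = a') (hu : u.val w M env = u') (hg : g.val w M env = g')
    (hr : r.val w M env = r') (hl : l.val w M env = l')
    (h1 : w * g' + w + r' ≤ 2 ^ w) (h2 : (a' + u' * g' + r') / w + 1 < 2 ^ w) :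
    (read a u g r l).val w M env = X / 2 ^ (a' + u' * g' + r') % 2 ^ l' % 2 ^ w := by
  have hs : u' % w * g' + a' % w + r' < 2 ^ w := by
    have h3 : u' % w * g' ≤ w * g' := Nat.mul_le_mul_right _ (Nat.mod_lt _ hw).le
    have h4 := Nat.mod_lt a' hw
    omega
  set s := u' % w * g' + a' % w + r' with hsdef
  have hpos : a' + u' * g' + r' = (a' / w + u' / w * g') * w + s := by
    have h3 := Nat.div_add_mod a' w
    have h4 : u' * g' = (w * (u' / w) + u' % w) * g' := by rw [Nat.div_add_mod]
    rw [hsdef, h4]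
    nlinarith
  have hq : (a' + u' * g' + r') / w = a' / w + u' / w * g' + s / w := by
    rw [hpos, add_comm, Nat.add_mul_div_right _ _ hw, add_comm]
  have hpos2 : a' + u' * g' + r' = (a' / w + u' / w * g' + s / w) * w + s % w := by
    rw [hpos]
    have := Nat.div_add_mod s w
    nlinarith
  rw [hq] at h2
  have ho := Nat.mod_lt s hw
  have hone : 1 < 2 ^ w := Nat.one_lt_two_pow hw.ne'
  have hwlt : w < 2 ^ w := Nat.lt_two_pow_self
  simp only [read, val, BinOp.natEval, ha, hu, hg, hr, hl, hW]
  have e0 : (u' % w * g') % 2 ^ w = u' % w * g' := Nat.mod_eq_of_lt (by omega)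
  have e1 : (u' % w * g' + a' % w) % 2 ^ w = u' % w * g' + a' % w := Nat.mod_eq_of_lt (by omega)
  have hle1 : u' / w * g' ≤ a' / w + u' / w * g' := Nat.le_add_left _ _
  have hle2 : a' / w + u' / w * g' ≤ a' / w + u' / w * g' + s / w := Nat.le_add_right _ _
  have hle3 := hle2.trans_lt ((Nat.lt_succ_self _).trans h2)
  have e2 : (u' / w * g') % 2 ^ w = u' / w * g' := Nat.mod_eq_of_lt (hle1.trans_lt hle3)
  have e3 : (a' / w + u' / w * g') % 2 ^ w = a' / w + u' / w * g' := Nat.mod_eq_of_lt hle3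
  have e4 : (a' / w + u' / w * g' + s / w) % 2 ^ w = a' / w + u' / w * g' + s / w :=
    Nat.mod_eq_of_lt (by omega)
  have e5 : (a' / w + u' / w * g' + s / w + 1) % 2 ^ w = a' / w + u' / w * g' + s / w + 1 :=
    Nat.mod_eq_of_lt (by omega)
  have e6 : (2 ^ w - s % w + w) % 2 ^ w = w - s % w := by
    rw [show 2 ^ w - s % w + w = w - s % w + 2 ^ w by omega, Nat.add_mod_right]
    exact Nat.mod_eq_of_lt (by omega)
  rw [Nat.mod_eq_of_lt hone, mask_eq hw, e0, e1, e2, e3, ← hsdef, Nat.mod_eq_of_lt hs, e4, e5, e6,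
    hM _ (by omega), hM _ (by omega), two_word_read _ _ _ _ ho, ← hpos2,
    Nat.and_two_pow_sub_one_eq_mod]
  apply Nat.eq_of_testBit_eq
  intro i
  simp only [Nat.testBit_mod_two_pow, lt_min_iff]
  by_cases hi1 : i < w <;> by_cases hi2 : i < l' <;> simp [hi1, hi2]

end Exp

end WordRAM

/-! ### Counting -/

/-- A decoder for the increasing sequences of length `b` below `s`. -/
theorem exists_decoder (b s : ℕ) : ∃ dec : ℕ → ℕ → ℕ, ∀ d : ℕ → ℕ,
    (∀ i j, i < j → j < b → d i < d j) → (∀ j < b, d j < s) →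
    ∃ v < s.choose b, ∀ j < b, dec v j = d j := by
  classical
  have hcard : (Finset.powersetCard b (Finset.range s)).card = s.choose b := by simp
  let E := Finset.equivFinOfCardEq hcard
  have hc (v : Fin (s.choose b)) : (E.symm v).1.card = b :=
    (Finset.mem_powersetCard.1 (E.symm v).2).2
  refine ⟨fun v j => if h : v < s.choose b ∧ j < b then
    (E.symm ⟨v, h.1⟩).1.orderEmbOfFin (hc _) ⟨j, h.2⟩ else 0, fun d hd hs => ?_⟩
  have hinj : ∀ i j : Fin b, d i = d j → i = j := by
    intro i j hij
    rcases lt_trichotomy i j with h | h | h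
    · have := hd i j h j.2; omega
    · exact h
    · have := hd j i h i.2; omega
  let t : Finset ℕ := Finset.univ.image fun i : Fin b => d i
  have ht : t ∈ Finset.powersetCard b (Finset.range s) := by
    rw [Finset.mem_powersetCard]
    refine ⟨?_, ?_⟩
    · intro x hx
      obtain ⟨i, -, rfl⟩ := Finset.mem_image.1 hx
      exact Finset.mem_range.2 (hs i i.2)
    · rw [Finset.card_image_of_injective _ fun i j h => hinj i j h]; simp
  refine ⟨E ⟨t, ht⟩, (E ⟨t, ht⟩).2, fun j hj => ?_⟩
  have h : (E ⟨t, ht⟩ : ℕ) < s.choose b ∧ j < b := ⟨(E ⟨t, ht⟩).2, hj⟩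
  simp only [dif_pos h]
  -- A finite set has only one increasing enumeration, so the decoded one is d.
  have := Finset.orderEmbOfFin_unique (hc (E ⟨t, ht⟩)) (f := fun i : Fin b => d i)
    (fun i => by
      rw [Equiv.symm_apply_apply]
      exact Finset.mem_image.2 ⟨i, Finset.mem_univ _, rfl⟩)
    (fun i k hik => hd i k hik k.2)
  exact (congrFun this ⟨j, hj⟩).symm

theorem choose_mul_choose_le_choose_add (x y p q : ℕ) :
    x.choose p * y.choose q ≤ (x + y).choose (p + q) := by
  rw [Nat.add_choose_eq]
  exact Finset.single_le_sum (f := fun ij : ℕ × ℕ => x.choose ij.1 * y.choose ij.2)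
    (fun _ _ => Nat.zero_le _) (a := (p, q)) (by simp)

/-- Iterated Vandermonde: choosing b elements in each of K consecutive intervals is one way of
choosing Kb elements in their union. -/
theorem prod_choose_le_choose {a : ℕ → ℕ} (ha : Monotone a) (b K : ℕ) :
    ∏ J ∈ Finset.range K, (a (J + 1) - a J).choose b ≤ (a K).choose (K * b) := by
  suffices h : ∏ J ∈ Finset.range K, (a (J + 1) - a J).choose b ≤ (a K - a 0).choose (K * b) from
    h.trans (Nat.choose_le_choose _ (Nat.sub_le _ _))
  induction K with
  | zero => simp
  | succ K ih =>
    rw [Finset.prod_range_succ]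
    refine (Nat.mul_le_mul_right _ ih).trans ((choose_mul_choose_le_choose_add _ _ _ _).trans ?_)
    have h1 := ha (Nat.zero_le K)
    have h2 : a K ≤ a (K + 1) := ha (Nat.le_succ K)
    rw [show a K - a 0 + (a (K + 1) - a K) = a (K + 1) - a 0 by omega, Nat.succ_mul]

theorem two_pow_clog_le {x : ℕ} (hx : 0 < x) : 2 ^ Nat.clog 2 x ≤ 2 * x := by
  rcases Nat.lt_or_ge 1 x with h | h
  · have h1 := Nat.pow_pred_clog_lt_self (b := 2) (by norm_num) h
    have h2 := Nat.clog_pos (b := 2) (by norm_num) h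
    obtain ⟨k, hk⟩ := Nat.exists_eq_succ_of_ne_zero h2.ne'
    rw [hk] at h1 ⊢
    rw [Nat.pred_succ] at h1
    rw [pow_succ]; omega
  · rw [show x = 1 by omega]; simp

theorem two_pow_sum_clog_le {C : ℕ → ℕ} {K : ℕ} (hC : ∀ J < K, 0 < C J) :
    2 ^ (∑ J ∈ Finset.range K, Nat.clog 2 (C J)) ≤ 2 ^ K * ∏ J ∈ Finset.range K, C J := by
  rw [← Finset.prod_pow_eq_pow_sum]
  calc _ ≤ ∏ J ∈ Finset.range K, 2 * C J :=
        Finset.prod_le_prod' fun J hJ => two_pow_clog_le (hC J (Finset.mem_range.1 hJ))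
    _ = _ := by rw [Finset.prod_mul_distrib]; simp

/-- The gaps are disjoint and add up to at most `a Q`. This bounds the number of sparse superblocks.
-/
theorem card_large_gaps_mul_le {a : ℕ → ℕ} (ha : Monotone a) (s Q : ℕ) :
    ((Finset.range Q).filter fun q => s ≤ a (q + 1) - a q).card * s ≤ a Q := by
  have h1 : ∑ q ∈ Finset.range Q, (a (q + 1) - a q) ≤ a Q := by
    rw [Finset.sum_range_tsub ha]; exact Nat.sub_le _ _
  refine le_trans ?_ h1
  rw [Finset.card_eq_sum_ones, Finset.sum_mul]
  refine (Finset.sum_le_sum fun q hq => ?_).trans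
    (Finset.sum_le_sum_of_subset (Finset.filter_subset _ _))
  rw [one_mul]; exact (Finset.mem_filter.1 hq).2

/-- The price of padding: each of the p elements appended to fill the last superblock costs a factor
of at most a + p. -/
theorem choose_add_le_mul_pow (a n p : ℕ) :
    (a + p).choose (n + p) ≤ a.choose n * (a + p) ^ p := by
  induction p with
  | zero => simp
  | succ p ih =>
    have h1 : (a + p + 1).choose (n + p + 1) ≤ (a + p + 1) * (a + p).choose (n + p) := by
      have := Nat.add_one_mul_choose_eq (a + p) (n + p)
      rw [this]
      exact Nat.le_mul_of_pos_right _ (by omega)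
    calc (a + (p + 1)).choose (n + (p + 1)) ≤ (a + p + 1) * (a + p).choose (n + p) := h1
      _ ≤ (a + p + 1) * (a.choose n * (a + p) ^ p) := Nat.mul_le_mul_left _ ih
      _ ≤ (a + p + 1) * (a.choose n * (a + p + 1) ^ p) :=
          Nat.mul_le_mul_left _ (Nat.mul_le_mul_left _ (Nat.pow_le_pow_left (by omega) p))
      _ = _ := by rw [← add_assoc]; ring

theorem pow_mul_descFactorial_le (K D n : ℕ) :
    K ^ n * D.descFactorial n ≤ (K * D).descFactorial n := by
  induction n with
  | zero => simp
  | succ n ih =>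
    rw [Nat.descFactorial_succ, Nat.descFactorial_succ, pow_succ]
    have h : K * (D - n) ≤ K * D - n := by
      rcases Nat.eq_zero_or_pos K with rfl | hK
      · simp
      · rw [Nat.mul_sub]
        have : n ≤ K * n := Nat.le_mul_of_pos_left _ hK
        omega
    calc K ^ n * K * ((D - n) * D.descFactorial n)
        = (K * (D - n)) * (K ^ n * D.descFactorial n) := by ring
      _ ≤ _ := Nat.mul_le_mul h ih

/-- (1 + 4/e)^n ≤ exp(4n/e) ≤ 4^(4n/e), because Euler's number is below 4. The 1 in the exponent
compensates for the rounded quotient. -/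
theorem add_four_pow_le (e n : ℕ) (he : 0 < e) : (e + 4) ^ n ≤ e ^ n * 2 ^ (8 * n / e + 1) := by
  have he' : (0 : ℝ) < e := by exact_mod_cast he
  have h1 : (1 + 4 / (e : ℝ)) ^ n ≤ (2 : ℝ) ^ (8 * n / e + 1) := by
    have h2 : 1 + 4 / (e : ℝ) ≤ Real.exp (4 / e) := by
      rw [add_comm]; exact Real.add_one_le_exp _
    have h3 : Real.exp 1 ≤ (2 : ℝ) ^ (2 : ℝ) := by
      have := Real.exp_one_lt_d9; norm_num; linarith
    have h4 : (8 * n / e : ℝ) ≤ ((8 * n / e + 1 : ℕ) : ℝ) := by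
      have := Nat.lt_floor_add_one ((8 * n : ℕ) / (e : ℕ) : ℝ)
      rw [Nat.floor_div_natCast, Nat.floor_natCast] at this
      push_cast at this ⊢
      exact this.le
    calc (1 + 4 / (e : ℝ)) ^ n ≤ Real.exp (4 / e) ^ n := by gcongr
      _ = Real.exp 1 ^ (4 * n / e : ℝ) := by
          rw [← Real.exp_nat_mul, ← Real.exp_mul]; congr 1; ring
      _ ≤ ((2 : ℝ) ^ (2 : ℝ)) ^ (4 * n / e : ℝ) :=
          Real.rpow_le_rpow (Real.exp_pos _).le h3 (by positivity)
      _ = (2 : ℝ) ^ (8 * n / e : ℝ) := by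
          rw [← Real.rpow_mul (by norm_num)]; congr 1; ring
      _ ≤ (2 : ℝ) ^ (((8 * n / e + 1 : ℕ) : ℝ)) :=
          Real.rpow_le_rpow_of_exponent_le (by norm_num) h4
      _ = _ := by rw [Real.rpow_natCast]
  have h5 : ((e : ℝ) + 4) ^ n ≤ (e : ℝ) ^ n * 2 ^ (8 * n / e + 1) := by
    have : (e : ℝ) + 4 = e * (1 + 4 / e) := by field_simp
    rw [this, mul_pow]
    gcongr
  exact_mod_cast h5

/-- Here D bounds the high parts and K = 2^k. Compare falling factorials factor by factor: enlarging
D to D + 1 + n costs a factor of at most (e + 4)/e each time, and multiplying each factor of D's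
falling factorial by K stays below that of KD ≤ m. -/
theorem choose_mul_pow_le {e n D K m : ℕ} (he : 2 ≤ e) (hn : 0 < n) (hD : n * e ≤ D)
    (hm : K * D ≤ m) :
    (D + 1 + n).choose n * K ^ n ≤ m.choose n * 2 ^ (8 * n / e + 1) := by
  have key : ∀ i ≤ n, (D + 1 + n).descFactorial i * e ^ i ≤ D.descFactorial i * (e + 4) ^ i := by
    intro i
    induction i with
    | zero => simp
    | succ i ih =>
      intro hi
      -- This amounts to (n + 1)e ≤ 4(D - i), which holds because D - i ≥ n(e - 1) ≥ ne/2.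
      have h1 : (D + 1 + n - i) * e ≤ (D - i) * (e + 4) := by
        obtain ⟨x, rfl⟩ : ∃ x, D = x + i := ⟨D - i, by
          have : n ≤ n * e := Nat.le_mul_of_pos_right _ (by omega)
          omega⟩
        rw [Nat.add_sub_cancel, show x + i + 1 + n - i = x + 1 + n by omega]
        nlinarith
      rw [Nat.descFactorial_succ, Nat.descFactorial_succ, pow_succ, pow_succ]
      calc (D + 1 + n - i) * (D + 1 + n).descFactorial i * (e ^ i * e)
          = ((D + 1 + n - i) * e) * ((D + 1 + n).descFactorial i * e ^ i) := by ring
        _ ≤ ((D - i) * (e + 4)) * (D.descFactorial i * (e + 4) ^ i) :=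
            Nat.mul_le_mul h1 (ih (by omega))
        _ = _ := by ring
  have h1 : (D + 1 + n).descFactorial n ≤ D.descFactorial n * 2 ^ (8 * n / e + 1) := by
    refine Nat.le_of_mul_le_mul_right ?_ (show 0 < e ^ n by positivity)
    calc _ ≤ D.descFactorial n * (e + 4) ^ n := key n le_rfl
      _ ≤ D.descFactorial n * (e ^ n * 2 ^ (8 * n / e + 1)) :=
          Nat.mul_le_mul_left _ (add_four_pow_le e n (by omega))
      _ = _ := by ring
  refine Nat.le_of_mul_le_mul_left ?_ (Nat.factorial_pos n)
  calc n.factorial * ((D + 1 + n).choose n * K ^ n)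
      = (D + 1 + n).descFactorial n * K ^ n := by rw [Nat.descFactorial_eq_factorial_mul_choose]; ring
    _ ≤ D.descFactorial n * 2 ^ (8 * n / e + 1) * K ^ n := Nat.mul_le_mul_right _ h1
    _ = (K ^ n * D.descFactorial n) * 2 ^ (8 * n / e + 1) := by ring
    _ ≤ m.descFactorial n * 2 ^ (8 * n / e + 1) := by
        gcongr
        exact (pow_mul_descFactorial_le K D n).trans (Nat.descFactorial_le _ hm)
    _ = _ := by rw [Nat.descFactorial_eq_factorial_mul_choose]; ring

/-- Crude bound for the plain array: n lg m exceeds the lower bound by at most 2n lg n bits, which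
is affordable while n is bounded. -/
theorem pow_le_choose_mul_pow {n m : ℕ} (hn : 0 < n) (hm : n ≤ m) :
    m ^ n ≤ m.choose n * n ^ (2 * n) := by
  have h1 : m ≤ n * (m + 1 - n) := by
    obtain ⟨x, rfl⟩ := Nat.exists_eq_add_of_le hm
    rw [show n + x + 1 - n = x + 1 by omega]
    nlinarith
  calc m ^ n ≤ (n * (m + 1 - n)) ^ n := Nat.pow_le_pow_left h1 n
    _ = n ^ n * (m + 1 - n) ^ n := mul_pow _ _ _
    _ ≤ n ^ n * m.descFactorial n := Nat.mul_le_mul_left _ (Nat.pow_sub_le_descFactorial m n)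
    _ = n ^ n * (n.factorial * m.choose n) := by rw [Nat.descFactorial_eq_factorial_mul_choose]
    _ ≤ n ^ n * (n ^ n * m.choose n) := by gcongr; exact Nat.factorial_le_pow n
    _ = _ := by rw [two_mul, pow_add]; ring

theorem setBits_eq_clog (n m : ℕ) : setBits n m = Nat.clog 2 (m.choose n) :=
  Real.natCeil_logb_natCast 2 (m.choose n)

/-! ### The layout of the data structure -/

theorem read_field {X p l g N : ℕ} {v : ℕ → ℕ}
    (h : X / 2 ^ p % 2 ^ l = packBits (fun i => g * i) v N) (hl : l = g * N)
    (hv : ∀ i < N, v i < 2 ^ g) {t : ℕ} (ht : t < N) : X / 2 ^ (p + g * t) % 2 ^ g = v t := by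
  have h1 : g * t + g ≤ l := by
    rw [hl, ← Nat.mul_succ]; exact Nat.mul_le_mul_left _ ht
  rw [div_mod_of_read h h1, packBits_fixed_read hv ht]

/-- The number of bits of the code for the elements `J * b, …, (J + 1) * b - 1` of `z`. -/
def blockLen (z : ℕ → ℕ) (b J : ℕ) : ℕ := Nat.clog 2 ((z ((J + 1) * b) - z (J * b)).choose b)

/-- The position of block `i` in the code of superblock `q`, if it consists of block codes. -/
def blockOff (z : ℕ → ℕ) (b c q i : ℕ) : ℕ := ∑ j ∈ Finset.range i, blockLen z b (q * c + j)

/-- A superblock of `c` blocks is sparse if its elements span at least `2 ^ sg` numbers. -/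
def IsSparse (z : ℕ → ℕ) (b c sg q : ℕ) : Prop :=
  2 ^ sg ≤ z ((q + 1) * c * b) - z (q * c * b)

instance (z : ℕ → ℕ) (b c sg q : ℕ) : Decidable (IsSparse z b c sg q) :=
  inferInstanceAs (Decidable (_ ≤ _))

/-- The number of bits of the code of a superblock. -/
def superLen (z : ℕ → ℕ) (b c sg L q : ℕ) : ℕ :=
  if IsSparse z b c sg q then 2 * L * (c * b) else blockOff z b c q c

/-- The position of the code of a superblock, in units of four bits. -/
def superPos (z : ℕ → ℕ) (b c sg L q : ℕ) : ℕ :=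
  ∑ j ∈ Finset.range q, (superLen z b c sg L j / 4 + 1)

theorem superPos_mono (z : ℕ → ℕ) (b c sg L : ℕ) : Monotone (superPos z b c sg L) :=
  monotone_nat_of_le_succ fun q => by
    rw [superPos, superPos, Finset.sum_range_succ]; exact Nat.le_add_right _ _

theorem blockOff_mono (z : ℕ → ℕ) (b c q : ℕ) : Monotone (blockOff z b c q) :=
  monotone_nat_of_le_succ fun i => by
    rw [blockOff, blockOff, Finset.sum_range_succ]; exact Nat.le_add_right _ _

theorem blockLen_le {z : ℕ → ℕ} {b sg J : ℕ} (h : z ((J + 1) * b) - z (J * b) < 2 ^ sg) :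
    blockLen z b J ≤ sg * b := by
  refine Nat.clog_le_of_le_pow ((Nat.choose_le_pow _ _).trans ?_)
  rw [pow_mul]; exact Nat.pow_le_pow_left h.le _

/-- The number of bits of the decoding table. -/
def tableBits (b sg : ℕ) : ℕ := sg * (2 ^ (sg + sg * b) * b)

/-- The position of the superblock records. -/
def superBase (b c Q sg : ℕ) : ℕ := tableBits b sg + sg * (3 * (Q * c))

/-- The position of the low-order bits. -/
def lowBase (b c Q sg L : ℕ) : ℕ := superBase b c Q sg + 2 * L * (3 * Q)

/-- The position of the codes. -/
def codeBase (b c Q sg L k n : ℕ) : ℕ := lowBase b c Q sg L + k * n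

/-- What a query for element `i` finds in the bit string `X` about the high-order part. -/
def ReadsHigh (z : ℕ → ℕ) (b c Q sg L k n X i : ℕ) : Prop :=
  ∃ U fl zs : ℕ,
    X / 2 ^ (superBase b c Q sg + 2 * L * (3 * (i / b / c))) % 2 ^ (2 * L) = zs ∧
    X / 2 ^ (superBase b c Q sg + 2 * L * (3 * (i / b / c) + 1)) % 2 ^ (2 * L) = U ∧
    X / 2 ^ (superBase b c Q sg + 2 * L * (3 * (i / b / c) + 2)) % 2 ^ (2 * L) = fl ∧
    U ≤ superPos z b c sg L Q ∧
    ((fl = 1 ∧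
      X / 2 ^ (codeBase b c Q sg L k n + U * 4 + i % (b * c) * (2 * L)) % 2 ^ (2 * L) = z i ∧
      U * 4 + i % (b * c) * (2 * L) ≤ 4 * superPos z b c sg L Q) ∨
    (fl = 0 ∧ ∃ rz s rp : ℕ,
      X / 2 ^ (tableBits b sg + sg * (3 * (i / b))) % 2 ^ sg = rz ∧
      X / 2 ^ (tableBits b sg + sg * (3 * (i / b) + 1)) % 2 ^ sg = s ∧
      X / 2 ^ (tableBits b sg + sg * (3 * (i / b) + 2)) % 2 ^ sg = rp ∧
      U * 4 + rp ≤ 4 * superPos z b c sg L Q ∧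
      ∀ v, X / 2 ^ (codeBase b c Q sg L k n + U * 4 + rp) % 2 ^ (sg * b) = v →
        zs + rz + X / 2 ^ (sg * ((s * 2 ^ (sg * b) + v) * b + i % b)) % 2 ^ sg = z i))

/-- The string consists of the decoding table, the block records, the superblock records, the low
bits and the superblock codes. Only the codes have variable length; they are padded to multiples of
four bits so that a position in units of four fits into a word. `hzL` and `hU` make the superblock
fields fit into 2L bits, and `hoff` makes the offset of a block within a dense superblock fit into
`sg` bits. -/
theorem exists_layout {z low : ℕ → ℕ} {b c Q sg L k n : ℕ} (hz : StrictMono z) (hb : 0 < b)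
    (hc : 0 < c) (hL : 0 < L) (hzL : z (Q * c * b) < 2 ^ (2 * L)) (hoff : c * (sg * b) < 2 ^ sg)
    (hU : superPos z b c sg L Q < 2 ^ (2 * L)) (hlow : ∀ i < n, low i < 2 ^ k)
    (hn : n ≤ Q * c * b) :
    ∃ X < 2 ^ (codeBase b c Q sg L k n + 4 * superPos z b c sg L Q), ∀ i < n,
      X / 2 ^ (lowBase b c Q sg L + k * i) % 2 ^ k = low i ∧ ReadsHigh z b c Q sg L k n X i := by
  classical
  choose dec hdec using exists_decoder b
  set h := sg * b with hh
  have hspan (J : ℕ) (j : ℕ) (hj : j < b) : z (J * b + j) < z ((J + 1) * b) :=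
    hz (by rw [Nat.succ_mul]; omega)
  -- A block is coded relative to its first element; its span ends at the first element of the next
  -- block.
  have hcode (J : ℕ) := hdec (z ((J + 1) * b) - z (J * b)) (fun j => z (J * b + j) - z (J * b))
    (fun i j hij hj => by
      have h1 : z (J * b) ≤ z (J * b + i) := hz.monotone (Nat.le_add_right _ _)
      have h2 : z (J * b + i) < z (J * b + j) := hz (by omega)
      show z (J * b + i) - z (J * b) < z (J * b + j) - z (J * b)
      omega)
    (fun j hj => by
      have h1 : z (J * b) ≤ z (J * b + j) := hz.monotone (Nat.le_add_right _ _)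
      have h2 := hspan J j hj
      show z (J * b + j) - z (J * b) < _
      omega)
  choose code hcode_lt hcode_dec using hcode
  have hcode_pow (J : ℕ) : code J < 2 ^ blockLen z b J :=
    (hcode_lt J).trans_le (Nat.le_pow_clog (by norm_num) _)
  -- the areas
  let tab (t : ℕ) : ℕ := dec (t / b / 2 ^ h)
    (t / b % 2 ^ h % 2 ^ Nat.clog 2 ((t / b / 2 ^ h).choose b)) (t % b) % 2 ^ sg
  -- In a sparse superblock these values may be too large for `sg` bits. They are truncated there,
  -- and never consulted.
  let rec1 (t : ℕ) : ℕ := (if t % 3 = 0 then z (t / 3 * b) - z (t / 3 / c * c * b)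
    else if t % 3 = 1 then z ((t / 3 + 1) * b) - z (t / 3 * b)
    else blockOff z b c (t / 3 / c) (t / 3 % c)) % 2 ^ sg
  let rec2 (t : ℕ) : ℕ := if t % 3 = 0 then z (t / 3 * c * b)
    else if t % 3 = 1 then superPos z b c sg L (t / 3)
    else if IsSparse z b c sg (t / 3) then 1 else 0
  let sup (q : ℕ) : ℕ := if IsSparse z b c sg q
    then packBits (fun i => 2 * L * i) (fun i => z (q * c * b + i)) (c * b)
    else packBits (blockOff z b c q) (fun i => code (q * c + i)) c
  have htab : ∀ t < 2 ^ (sg + h) * b, tab t < 2 ^ sg := fun t _ => Nat.mod_lt _ (by positivity)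
  have hrec1 : ∀ t < 3 * (Q * c), rec1 t < 2 ^ sg := fun t _ => Nat.mod_lt _ (by positivity)
  have hrec2 : ∀ t < 3 * Q, rec2 t < 2 ^ (2 * L) := by
    intro t ht
    have hq : t / 3 < Q := by omega
    simp only [rec2]
    split_ifs
    · exact (hz.monotone (Nat.mul_le_mul_right _ (Nat.mul_le_mul_right _ hq.le))).trans_lt hzL
    · exact (superPos_mono z b c sg L hq.le).trans_lt hU
    · exact Nat.one_lt_two_pow (by omega)
    · positivity
  have hzq : ∀ q < Q, ∀ i < c * b, z (q * c * b + i) < 2 ^ (2 * L) := by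
    intro q hq i hi
    refine (hz.monotone ?_).trans_lt hzL
    have : (q + 1) * (c * b) ≤ Q * (c * b) := Nat.mul_le_mul_right _ hq
    have h2 : (q + 1) * (c * b) = q * c * b + c * b := by ring
    have h3 : Q * (c * b) = Q * c * b := by ring
    omega
  have hoffP (q : ℕ) : ∀ i < c, blockOff z b c q i ≤ blockOff z b c q (i + 1) :=
    fun i _ => blockOff_mono z b c q (Nat.le_succ i)
  have hoffS (q i : ℕ) : blockOff z b c q (i + 1) - blockOff z b c q i
      = blockLen z b (q * c + i) := by
    rw [blockOff, Finset.sum_range_succ, ← blockOff]; omega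
  have hoffV (q : ℕ) : ∀ i < c,
      code (q * c + i) < 2 ^ (blockOff z b c q (i + 1) - blockOff z b c q i) := by
    intro i _; rw [hoffS]; exact hcode_pow _
  have hsupL : ∀ q < Q, sup q < 2 ^ superLen z b c sg L q := by
    intro q hq
    simp only [sup, superLen]
    split_ifs with hs
    · exact packBits_fixed_lt (hzq q hq)
    · exact packBits_lt (hoffP q) (hoffV q)
  have hsupS (q : ℕ) : 4 * superPos z b c sg L (q + 1) - 4 * superPos z b c sg L q
      = 4 * (superLen z b c sg L q / 4 + 1) := by
    rw [superPos, Finset.sum_range_succ, ← superPos]; omega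
  have hsupP : ∀ q < Q, 4 * superPos z b c sg L q ≤ 4 * superPos z b c sg L (q + 1) :=
    fun q _ => Nat.mul_le_mul_left _ (superPos_mono z b c sg L (Nat.le_succ q))
  have hsupV : ∀ q < Q,
      sup q < 2 ^ (4 * superPos z b c sg L (q + 1) - 4 * superPos z b c sg L q) := by
    intro q hq
    rw [hsupS]
    exact (hsupL q hq).trans_le (Nat.pow_le_pow_right (by norm_num) (by omega))
  let pos : ℕ → ℕ
    | 0 => 0
    | 1 => tableBits b sg
    | 2 => superBase b c Q sg
    | 3 => lowBase b c Q sg L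
    | 4 => codeBase b c Q sg L k n
    | _ => codeBase b c Q sg L k n + 4 * superPos z b c sg L Q
  let area : ℕ → ℕ
    | 0 => packBits (fun i => sg * i) tab (2 ^ (sg + h) * b)
    | 1 => packBits (fun i => sg * i) rec1 (3 * (Q * c))
    | 2 => packBits (fun i => 2 * L * i) rec2 (3 * Q)
    | 3 => packBits (fun i => k * i) low n
    | _ => packBits (fun q => 4 * superPos z b c sg L q) sup Q
  have hpos : ∀ i < 5, pos i ≤ pos (i + 1) := by
    intro i hi
    interval_cases i <;> simp [pos, superBase, lowBase, codeBase]
  have harea : ∀ i < 5, area i < 2 ^ (pos (i + 1) - pos i) := by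
    intro i hi
    interval_cases i
    · exact packBits_fixed_lt htab
    · simpa [pos, superBase, area] using packBits_fixed_lt hrec1
    · simpa [pos, lowBase, area] using packBits_fixed_lt hrec2
    · simpa [pos, codeBase, area] using packBits_fixed_lt hlow
    · simpa [pos, area] using packBits_lt hsupP hsupV
  refine ⟨packBits pos area 5, packBits_lt hpos harea, fun i hi => ?_⟩
  set X := packBits pos area 5 with hX
  have r0 : X / 2 ^ 0 % 2 ^ tableBits b sg = _ := packBits_read hpos harea (i := 0) (by norm_num)
  have r1 : X / 2 ^ tableBits b sg % 2 ^ (superBase b c Q sg - tableBits b sg) = _ :=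
    packBits_read hpos harea (i := 1) (by norm_num)
  have r2 : X / 2 ^ superBase b c Q sg % 2 ^ (lowBase b c Q sg L - superBase b c Q sg) = _ :=
    packBits_read hpos harea (i := 2) (by norm_num)
  have r3 : X / 2 ^ lowBase b c Q sg L % 2 ^ (codeBase b c Q sg L k n - lowBase b c Q sg L) = _ :=
    packBits_read hpos harea (i := 3) (by norm_num)
  have r4 : X / 2 ^ codeBase b c Q sg L k n % 2 ^ (codeBase b c Q sg L k n +
      4 * superPos z b c sg L Q - codeBase b c Q sg L k n) = _ :=
    packBits_read hpos harea (i := 4) (by norm_num)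
  refine ⟨read_field r3 (by simp [codeBase]) hlow hi, ?_⟩
  -- the indices of the block and the superblock
  have hidx : i = i / b * b + i % b := (Nat.div_add_mod' i b).symm
  have hidx2 : i / b = i / b / c * c + i / b % c := (Nat.div_add_mod' _ c).symm
  have hidx3 : i = i / b / c * c * b + i % (b * c) := by
    rw [Nat.div_div_eq_div_mul, mul_assoc, mul_comm c b]; exact (Nat.div_add_mod' i (b * c)).symm
  have hjb : i % b < b := Nat.mod_lt _ hb
  have hjc : i / b % c < c := Nat.mod_lt _ hc
  have hjbc : i % (b * c) < c * b := by rw [mul_comm c b]; exact Nat.mod_lt _ (by positivity)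
  set J := i / b with hJ
  set q := J / c with hq
  have hqQ : q < Q := by
    by_contra hcon
    have : Q * c * b ≤ q * c * b :=
      Nat.mul_le_mul_right _ (Nat.mul_le_mul_right _ (not_lt.1 hcon))
    omega
  have hJQ : J < Q * c := by
    have h1 : (q + 1) * c ≤ Q * c := Nat.mul_le_mul_right _ hqQ
    have h2 : (q + 1) * c = q * c + c := by ring
    omega
  have e0 (t : ℕ) : 3 * t / 3 = t := by omega
  have e1 (t : ℕ) : (3 * t + 1) / 3 = t := by omega
  have e2 (t : ℕ) : (3 * t + 2) / 3 = t := by omega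
  have f1 (t : ℕ) : (3 * t + 1) % 3 = 1 := by omega
  have f2 (t : ℕ) : (3 * t + 2) % 3 = 2 := by omega
  have g0 := read_field r2 (by simp [lowBase]) hrec2 (t := 3 * q) (by omega)
  have g1 := read_field r2 (by simp [lowBase]) hrec2 (t := 3 * q + 1) (by omega)
  have g2 := read_field r2 (by simp [lowBase]) hrec2 (t := 3 * q + 2) (by omega)
  simp only [rec2, e0, Nat.mul_mod_right, if_true] at g0
  simp only [rec2, e1, f1, one_ne_zero, if_false, if_true] at g1
  simp only [rec2, e2, f2, OfNat.ofNat_ne_zero, OfNat.ofNat_ne_one, if_false] at g2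
  have hUle := superPos_mono z b c sg L hqQ.le
  have hUle' := superPos_mono z b c sg L (show q + 1 ≤ Q from hqQ)
  refine ⟨_, _, _, g0, g1, g2, hUle, ?_⟩
  have hsup : X / 2 ^ (codeBase b c Q sg L k n + 4 * superPos z b c sg L q) %
      2 ^ (4 * (superLen z b c sg L q / 4 + 1)) = sup q := by
    have := packBits_read hsupP hsupV hqQ
    rw [hsupS] at this
    have h1 := hsupS q
    have h2 := hsupP q hqQ
    exact (div_mod_of_read r4 (by omega)).trans this
  have hsupS' := hsupS q
  have hsupP' := hsupP q hqQ
  by_cases hs : IsSparse z b c sg q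
  · left
    have hsl : superLen z b c sg L q = 2 * L * (c * b) := by rw [superLen, if_pos hs]
    have hle : 2 * L * (i % (b * c)) + 2 * L ≤ superLen z b c sg L q := by
      rw [hsl, ← Nat.mul_succ]; exact Nat.mul_le_mul_left _ hjbc
    refine ⟨by rw [if_pos hs], ?_, ?_⟩
    · have hsq : sup q = packBits (fun i => 2 * L * i) (fun i => z (q * c * b + i)) (c * b) := by
        simp only [sup]; rw [if_pos hs]
      rw [mul_comm (superPos z b c sg L q) 4, mul_comm (i % (b * c)) (2 * L),
        div_mod_of_read hsup (by omega), hsq, packBits_fixed_read (hzq q hqQ) hjbc, ← hidx3]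
    · rw [mul_comm (i % (b * c)) (2 * L)]
      omega
  · right
    have hsl : superLen z b c sg L q = blockOff z b c q c := by rw [superLen, if_neg hs]
    refine ⟨by rw [if_neg hs], _, _, _,
      read_field r1 (by simp [superBase]) hrec1 (t := 3 * J) (by omega),
      read_field r1 (by simp [superBase]) hrec1 (t := 3 * J + 1) (by omega),
      read_field r1 (by simp [superBase]) hrec1 (t := 3 * J + 2) (by omega), ?_⟩
    simp only [rec1, e0, e1, e2, f1, f2, Nat.mul_mod_right, if_true, if_false, one_ne_zero,
      OfNat.ofNat_ne_zero, OfNat.ofNat_ne_one, ← hq]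
    have hdense : z ((q + 1) * c * b) - z (q * c * b) < 2 ^ sg := not_le.1 hs
    have hin (j : ℕ) (hj : j < c) : z ((q * c + j + 1) * b) ≤ z ((q + 1) * c * b) := by
      refine hz.monotone (Nat.mul_le_mul_right _ ?_)
      rw [Nat.succ_mul]; omega
    have hin2 (j : ℕ) : z (q * c * b) ≤ z ((q * c + j) * b) :=
      hz.monotone (Nat.mul_le_mul_right _ (by omega))
    have hJspan : z (J * b) < z ((J + 1) * b) := hz (Nat.mul_lt_mul_of_pos_right (by omega) hb)
    have hJ1 := hin (J % c) hjc
    have hJ2 := hin2 (J % c)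
    rw [← hidx2] at hJ1 hJ2
    have hlen (j : ℕ) (hj : j < c) : blockLen z b (q * c + j) ≤ sg * b := by
      have h1 := hin j hj
      have h2 := hin2 j
      exact blockLen_le (by omega)
    have hrp : blockOff z b c q (J % c) < 2 ^ sg := by
      refine lt_of_le_of_lt ?_ hoff
      calc blockOff z b c q (J % c) ≤ ∑ _j ∈ Finset.range (J % c), sg * b :=
            Finset.sum_le_sum fun j hj => hlen j ((Finset.mem_range.1 hj).trans hjc)
        _ = J % c * (sg * b) := by simp
        _ ≤ _ := Nat.mul_le_mul_right _ hjc.le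
    rw [Nat.mod_eq_of_lt (show z (J * b) - z (q * c * b) < 2 ^ sg by omega),
      Nat.mod_eq_of_lt (show z ((J + 1) * b) - z (J * b) < 2 ^ sg by omega),
      Nat.mod_eq_of_lt hrp]
    have hend : blockOff z b c q (J % c) + blockLen z b J ≤ blockOff z b c q c := by
      have h1 := blockOff_mono z b c q (show J % c + 1 ≤ c from hjc)
      have h2 := hoffS q (J % c)
      have h3 := hoffP q (J % c) hjc
      rw [← hidx2] at h2
      omega
    refine ⟨by omega, fun v hv => ?_⟩
    have hvlt : v < 2 ^ h := by rw [← hv]; exact Nat.mod_lt _ (by positivity)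
    have hlenJ : blockLen z b J ≤ h := by have := hlen _ hjc; rwa [← hidx2] at this
    -- The query reads h bits regardless of the length of the code. The surplus belongs to whatever
    -- follows; the table drops it, as the span s determines the length.
    have hvcode : v % 2 ^ blockLen z b J = code J := by
      have hsq : sup q = packBits (blockOff z b c q) (fun i => code (q * c + i)) c := by
        simp only [sup]; rw [if_neg hs]
      have h1 := packBits_read (hoffP q) (hoffV q) hjc
      rw [hoffS, ← hidx2] at h1
      rw [← h1, ← hsq, ← hv, Nat.mod_mod_of_dvd _ (Nat.pow_dvd_pow 2 hlenJ),
        mul_comm (superPos z b c sg L q) 4, div_mod_of_read hsup (by omega)]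
    set s := z ((J + 1) * b) - z (J * b) with hsdef
    have hslt : s < 2 ^ sg := by omega
    have ht : (s * 2 ^ h + v) * b + i % b < 2 ^ (sg + h) * b := by
      have h1 : s * 2 ^ h + v + 1 ≤ 2 ^ (sg + h) := by
        rw [pow_add]
        calc s * 2 ^ h + v + 1 ≤ s * 2 ^ h + 2 ^ h := by omega
          _ = (s + 1) * 2 ^ h := by ring
          _ ≤ _ := Nat.mul_le_mul_right _ hslt
      calc (s * 2 ^ h + v) * b + i % b < (s * 2 ^ h + v + 1) * b := by rw [Nat.succ_mul]; omega
        _ ≤ _ := Nat.mul_le_mul_right _ h1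
    have h5 := read_field r0 rfl htab ht
    rw [zero_add] at h5
    rw [h5]
    have t1 : ((s * 2 ^ h + v) * b + i % b) / b = s * 2 ^ h + v := by
      rw [mul_comm, Nat.mul_add_div hb, Nat.div_eq_of_lt hjb, add_zero]
    have t2 : ((s * 2 ^ h + v) * b + i % b) % b = i % b := by
      rw [Nat.mul_add_mod', Nat.mod_mod]
    have t3 : (s * 2 ^ h + v) / 2 ^ h = s := by
      rw [mul_comm, Nat.mul_add_div (by positivity), Nat.div_eq_of_lt hvlt, add_zero]
    have t4 : (s * 2 ^ h + v) % 2 ^ h = v := by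
      rw [Nat.mul_add_mod', Nat.mod_eq_of_lt hvlt]
    simp only [tab, t1, t2, t3, t4]
    have h6 : v % 2 ^ Nat.clog 2 (s.choose b) = code J := hvcode
    have h7 : dec s (code J) (i % b) = z (J * b + i % b) - z (J * b) := hcode_dec J _ hjb
    have h8 := hspan J _ hjb
    have h9 : z (J * b) ≤ z (J * b + i % b) := hz.monotone (Nat.le_add_right _ _)
    rw [h6, h7, ← hidx] at *
    rw [Nat.mod_eq_of_lt (by omega)]
    omega

/-! ### The space bound -/

theorem sum_range_mul_eq (f : ℕ → ℕ) (Q c : ℕ) :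
    ∑ q ∈ Finset.range Q, ∑ i ∈ Finset.range c, f (q * c + i) = ∑ J ∈ Finset.range (Q * c), f J := by
  induction Q with
  | zero => simp
  | succ Q ih => rw [Finset.sum_range_succ, ih, Nat.succ_mul, Finset.sum_range_add]

/-- The total length of the block codes. -/
def blockSum (z : ℕ → ℕ) (b K : ℕ) : ℕ := ∑ J ∈ Finset.range K, blockLen z b J

/-- Rounding the code lengths up costs one bit per block. A block of b elements spans at least b
numbers since z is strictly increasing, so no binomial is zero. -/
theorem two_pow_blockSum_le {z : ℕ → ℕ} (hz : StrictMono z) (b K : ℕ) :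
    2 ^ blockSum z b K ≤ 2 ^ K * (z (K * b)).choose (K * b) := by
  refine (two_pow_sum_clog_le fun J _ => Nat.choose_pos ?_).trans (Nat.mul_le_mul_left _
    (prod_choose_le_choose (a := fun J => z (J * b))
      (fun i j h => hz.monotone (Nat.mul_le_mul_right b h)) b K))
  have := hz.add_le_nat b (J * b)
  rw [Nat.succ_mul, add_comm (J * b) b]
  omega

/-- Here x is the number of sparse superblocks; each has a gap of at least 2^sg. The term 4Q pays
for rounding to units of four bits. -/
theorem four_mul_superPos_le {z : ℕ → ℕ} (hz : StrictMono z) (b c Q sg L : ℕ) :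
    ∃ x : ℕ, x * 2 ^ sg ≤ z (Q * c * b) ∧
      4 * superPos z b c sg L Q ≤ blockSum z b (Q * c) + 4 * Q + x * (2 * L * (c * b)) := by
  refine ⟨_, card_large_gaps_mul_le (a := fun q => z (q * c * b)) (fun i j h => hz.monotone
    (Nat.mul_le_mul_right b (Nat.mul_le_mul_right c h))) (2 ^ sg) Q, ?_⟩
  rw [blockSum, ← sum_range_mul_eq, superPos, Finset.mul_sum, Finset.card_eq_sum_ones,
    Finset.sum_mul, Finset.sum_filter]
  have h4 : 4 * Q = ∑ q ∈ Finset.range Q, 4 := by simp [mul_comm]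
  rw [h4, ← Finset.sum_add_distrib, ← Finset.sum_add_distrib]
  refine Finset.sum_le_sum fun q _ => ?_
  rw [superLen]
  by_cases hs : IsSparse z b c sg q
  · have hs' : 2 ^ sg ≤ z ((q + 1) * c * b) - z (q * c * b) := hs
    rw [if_pos hs, if_pos hs']
    omega
  · have hs' : ¬ (2 ^ sg ≤ z ((q + 1) * c * b) - z (q * c * b)) := hs
    rw [if_neg hs, if_neg hs', blockOff]
    omega

/-- The growth estimate behind the bounds under `Scale`: as 2^e ≤ L and 2^L ≤ n, a polynomial in e
is below L, and 2 to that power is below n. -/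
theorem pow_growth {e : ℕ} (he : 100 ≤ e) : 16 * e ^ 4 + 16 * e ^ 3 + 16 * e + 16 ≤ 2 ^ e := by
  induction e, he using Nat.le_induction with
  | base => norm_num
  | succ e he ih =>
    rw [pow_succ 2 e]
    have h2 : e * e ≥ 100 * e := Nat.mul_le_mul_right _ he
    have h3 : e * (e * e) ≥ 100 * (e * e) := Nat.mul_le_mul_right _ he
    have h4 : e * (e * (e * e)) ≥ 100 * (e * (e * e)) := Nat.mul_le_mul_right _ he
    ring_nf at *
    nlinarith

/-! ### Size estimates for blocks of e² elements, superblocks of 2^(2e) blocks and local fields of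
4e bits -/

/-- The relations between `n` and the parameters `L = ⌊lg n⌋` and `e = ⌊lg L⌋`. -/
structure Scale (e L n : ℕ) : Prop where
  large : 100 ≤ e
  le_L : 2 ^ e ≤ L
  L_lt : L < 2 ^ (e + 1)
  le_n : 2 ^ L ≤ n
  n_lt : n < 2 ^ (L + 1)

theorem scale_log {n : ℕ} (h : 100 ≤ Nat.log 2 (Nat.log 2 n)) :
    Scale (Nat.log 2 (Nat.log 2 n)) (Nat.log 2 n) n := by
  have hL : Nat.log 2 n ≠ 0 := by intro h0; rw [h0] at h; simp at h
  have hn : n ≠ 0 := by rintro rfl; simp at hL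
  exact ⟨h, Nat.pow_log_le_self 2 hL, Nat.lt_pow_succ_log_self (by norm_num) _,
    Nat.pow_log_le_self 2 hn, Nat.lt_pow_succ_log_self (by norm_num) _⟩

/-- The number of superblocks. -/
def numSuper (e n : ℕ) : ℕ := n / (e * e * 2 ^ (2 * e)) + 1

namespace Scale

variable {e L n : ℕ}

theorem two_pow_le (s : Scale e L n) {x : ℕ} (h : x ≤ 16 * e ^ 4 + 16 * e ^ 3 + 16 * e + 16) :
    2 ^ x ≤ n :=
  (Nat.pow_le_pow_right (by norm_num) (h.trans ((pow_growth s.large).trans s.le_L))).trans s.le_n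

theorem e_le (_ : Scale e L n) : e ≤ 2 ^ e := Nat.lt_two_pow_self.le

/-- The block size is polynomial in e precisely for this: the table has 2^O(e³) bits, while n ≥
2^(2^e). -/
theorem table_le (s : Scale e L n) : tableBits (e * e) (4 * e) * e ≤ n := by
  refine le_trans ?_ (s.two_pow_le (x := 4 * e + 4 * e ^ 3 + 4 * e + 2) (by
    have := s.large
    nlinarith [Nat.zero_le (e ^ 4), Nat.zero_le (e ^ 3)]))
  have := s.e_le
  calc tableBits (e * e) (4 * e) * e
      = 4 * (e * e * e * e) * 2 ^ (4 * e + 4 * e * (e * e)) := by rw [tableBits]; ring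
    _ ≤ 4 * (2 ^ e * 2 ^ e * 2 ^ e * 2 ^ e) * 2 ^ (4 * e + 4 * e * (e * e)) := by gcongr
    _ = _ := by
      rw [← pow_add, ← pow_add, ← pow_add, show 4 = 2 ^ 2 by norm_num, ← pow_add, ← pow_add]
      congr 1
      ring

/-- Padding adds at most one superblock of elements, at 2L bits each; by this bound that is at most
n/e bits. -/
theorem superblock_le (s : Scale e L n) : 2 ^ (2 * e) * (e * e) * (2 * L) * e ≤ n := by
  refine le_trans ?_ (s.two_pow_le (x := 6 * e + 2) (by
    have := s.large
    nlinarith [Nat.zero_le (e ^ 4), Nat.zero_le (e ^ 3)]))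
  have := s.e_le
  have := s.L_lt.le
  calc 2 ^ (2 * e) * (e * e) * (2 * L) * e
      ≤ 2 ^ (2 * e) * (2 ^ e * 2 ^ e) * (2 * 2 ^ (e + 1)) * 2 ^ e := by gcongr
    _ = _ := by ring

theorem L_pos (s : Scale e L n) : 0 < L := lt_of_lt_of_le (by positivity) s.le_L

theorem n_pos (s : Scale e L n) : 0 < n := lt_of_lt_of_le (by positivity) s.le_n

theorem padded_eq (e n : ℕ) :
    numSuper e n * 2 ^ (2 * e) * (e * e) = numSuper e n * (e * e * 2 ^ (2 * e)) := by ring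

theorem le_padded (s : Scale e L n) : n ≤ numSuper e n * 2 ^ (2 * e) * (e * e) := by
  rw [padded_eq]
  have he : 0 < e := by have := s.large; omega
  exact (Nat.lt_mul_of_div_lt (Nat.lt_succ_self _) (by positivity)).le

theorem padded_le' (_ : Scale e L n) :
    numSuper e n * 2 ^ (2 * e) * (e * e) ≤ n + 2 ^ (2 * e) * (e * e) := by
  rw [padded_eq, numSuper, Nat.add_mul, one_mul, mul_comm (e * e)]
  exact Nat.add_le_add_right (Nat.div_mul_le_self _ _) _

theorem padded_le (s : Scale e L n) : numSuper e n * 2 ^ (2 * e) * (e * e) ≤ 2 * n := by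
  refine s.padded_le'.trans ?_
  have h1 := s.superblock_le
  have h2 : 0 < 2 * L * e := by
    have := s.L_pos; have := s.large; positivity
  have h3 : 2 ^ (2 * e) * (e * e) ≤ 2 ^ (2 * e) * (e * e) * (2 * L * e) :=
    Nat.le_mul_of_pos_right _ h2
  have h4 : 2 ^ (2 * e) * (e * e) * (2 * L * e) = 2 ^ (2 * e) * (e * e) * (2 * L) * e := by ring
  omega

theorem numBlocks_le (s : Scale e L n) : numSuper e n * 2 ^ (2 * e) * e ≤ 2 * n := by
  refine le_trans (Nat.mul_le_mul_left _ ?_) s.padded_le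
  exact Nat.le_mul_of_pos_left _ (by have := s.large; omega)

theorem numSuper_le (s : Scale e L n) : numSuper e n * (6 * L + 4) * e ≤ 2 * n := by
  refine le_trans ?_ s.padded_le
  have h1 := s.L_lt
  have h2 := s.large
  have h3 := pow_growth h2
  have h4 : 6 * L + 4 ≤ 2 ^ (2 * e) := by
    rw [two_mul, pow_add]
    rw [pow_succ] at h1
    have : 16 * 2 ^ e ≤ 2 ^ e * 2 ^ e := Nat.mul_le_mul_right _ (by omega)
    omega
  calc numSuper e n * (6 * L + 4) * e ≤ numSuper e n * 2 ^ (2 * e) * e := by gcongr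
    _ ≤ _ := Nat.mul_le_mul_left _ (Nat.le_mul_of_pos_left _ (by omega))

theorem lowBase_le (s : Scale e L n) :
    lowBase (e * e) (2 ^ (2 * e)) (numSuper e n) (4 * e) L * e ≤ 27 * n := by
  have h1 := s.table_le
  have h2 := s.padded_le
  have h3 := s.numSuper_le
  have e1 : lowBase (e * e) (2 ^ (2 * e)) (numSuper e n) (4 * e) L * e =
      tableBits (e * e) (4 * e) * e + 12 * (numSuper e n * 2 ^ (2 * e) * (e * e)) +
      numSuper e n * (6 * L) * e := by
    rw [lowBase, superBase]; ring
  have h4 : numSuper e n * (6 * L) * e ≤ numSuper e n * (6 * L + 4) * e := by gcongr; omega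
  omega

/-- At most 4ne / 2^(4e) superblocks, each of 2L · 2^(2e) e² bits with L < 2^(e+1), make at most 16
n e³ / 2^e ≤ n/e bits. -/
theorem sparse_le (s : Scale e L n) {x : ℕ} (hx : x * 2 ^ (4 * e) ≤ 4 * n * e) :
    x * (2 * L * (2 ^ (2 * e) * (e * e))) * e ≤ n := by
  have h1 := s.L_lt
  have h2 := s.large
  have h3 := pow_growth h2
  have h4 : 16 * e ^ 4 ≤ 2 ^ e := by
    have := Nat.zero_le (e ^ 3); omega
  refine Nat.le_of_mul_le_mul_right (c := 4 * e) ?_ (by omega)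
  calc x * (2 * L * (2 ^ (2 * e) * (e * e))) * e * (4 * e)
      ≤ x * (2 * 2 ^ (e + 1) * (2 ^ (2 * e) * (e * e))) * e * (4 * e) := by gcongr
    _ = x * (2 ^ (3 * e) * (16 * e ^ 4)) := by ring
    _ ≤ x * (2 ^ (3 * e) * 2 ^ e) := by gcongr
    _ = x * 2 ^ (4 * e) := by ring
    _ ≤ 4 * n * e := hx
    _ = _ := by ring

theorem mul_e_lt (s : Scale e L n) : 4 * n * e < 2 ^ (2 * L) := by
  have h1 := s.n_lt
  have h2 := s.large
  have h3 := pow_growth h2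
  have h4 : 8 * e ≤ 2 ^ L := by
    have := s.le_L
    have := Nat.lt_two_pow_self (n := L)
    have := Nat.zero_le (e ^ 3)
    have := Nat.zero_le (e ^ 4)
    omega
  calc 4 * n * e < 4 * 2 ^ (L + 1) * e := by gcongr
    _ = 2 ^ L * (8 * e) := by ring
    _ ≤ 2 ^ L * 2 ^ L := by gcongr
    _ = _ := by rw [two_mul, pow_add]

theorem blockOff_lt (s : Scale e L n) : 2 ^ (2 * e) * (4 * e * (e * e)) < 2 ^ (4 * e) := by
  have h2 := s.large
  have h3 := pow_growth h2
  have h4 : 4 * e * (e * e) < 2 ^ (2 * e) := by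
    calc 4 * e * (e * e) = 4 * e ^ 3 := by ring
      _ < 2 ^ e := by have := Nat.zero_le (e ^ 4); omega
      _ ≤ _ := Nat.pow_le_pow_right (by norm_num) (by omega)
  calc _ < 2 ^ (2 * e) * 2 ^ (2 * e) := by gcongr
    _ = _ := by ring

/-- The crude bound of 2^z on a binomial suffices here: positions only have to fit into fields of 2L
bits. -/
theorem superPos_lt (s : Scale e L n) {z : ℕ → ℕ} (hz : StrictMono z)
    (hzn : z (numSuper e n * 2 ^ (2 * e) * (e * e)) ≤ 4 * n * e) :
    superPos z (e * e) (2 ^ (2 * e)) (4 * e) L (numSuper e n) < 2 ^ (2 * L) := by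
  obtain ⟨x, hx, hle⟩ := four_mul_superPos_le hz (e * e) (2 ^ (2 * e)) (numSuper e n) (4 * e) L
  have h1 := s.sparse_le (hx.trans hzn)
  have h2 : blockSum z (e * e) (numSuper e n * 2 ^ (2 * e)) ≤
      numSuper e n * 2 ^ (2 * e) + 4 * n * e := by
    refine (Nat.pow_le_pow_iff_right (a := 2) (by norm_num)).1
      ((two_pow_blockSum_le hz _ _).trans ?_)
    rw [pow_add]
    gcongr
    exact (Nat.choose_le_two_pow _ _).trans (Nat.pow_le_pow_right (by norm_num) hzn)
  have h3 := s.mul_e_lt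
  have h4 := s.numSuper_le
  have h5 := s.numBlocks_le
  have he := s.large
  have g1 : x * (2 * L * (2 ^ (2 * e) * (e * e))) ≤ n :=
    (Nat.le_mul_of_pos_right _ (by omega)).trans h1
  have g2 : numSuper e n * 2 ^ (2 * e) ≤ 2 * n :=
    (Nat.le_mul_of_pos_right _ (by omega)).trans h5
  have g3 : numSuper e n * 4 ≤ 2 * n := by
    refine le_trans (le_trans (Nat.mul_le_mul_left _ ?_) (Nat.le_mul_of_pos_right _ (by omega))) h4
    omega
  have g4 : n * 100 ≤ n * e := Nat.mul_le_mul_left _ he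
  have g5 : 4 * n * e = 4 * (n * e) := by ring
  omega

end Scale

/-! ### Splitting off the low-order bits, and the total length -/

/-- The high-order parts of the numbers `x 0, …, x (n - 1)` below `N * 2 ^ k`, made strictly
increasing if `dl = 1`, and continued. -/
def highSeq (x : ℕ → ℕ) (k dl N n i : ℕ) : ℕ :=
  if i < n then x i / 2 ^ k + dl * i else N + dl * n + (i - n)

/-- Quotients by 2^k may repeat, and adding the index separates them; for k = 0 the numbers are
already distinct. The continuation starts at N, which exceeds every quotient. -/
theorem highSeq_strictMono {x : ℕ → ℕ} {k dl m n : ℕ} (hx : ∀ i j, i < j → j < n → x i < x j)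
    (hm : ∀ i < n, x i < m) (hdl : dl = 0 ∧ k = 0 ∨ dl = 1) :
    StrictMono (highSeq x k dl ((m - 1) / 2 ^ k + 1) n) := by
  refine strictMono_nat_of_lt_succ fun i => ?_
  rw [highSeq, highSeq]
  rcases lt_trichotomy (i + 1) n with h | h | h
  · rw [if_pos (by omega), if_pos h]
    have hlt := hx i (i + 1) (by omega) h
    rcases hdl with ⟨rfl, rfl⟩ | rfl
    · simpa using hlt
    · have : x i / 2 ^ k ≤ x (i + 1) / 2 ^ k := Nat.div_le_div_right hlt.le
      omega
  · rw [if_pos (by omega), if_neg (by omega), ← h]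
    have h1 : x i / 2 ^ k ≤ (m - 1) / 2 ^ k :=
      Nat.div_le_div_right (by have := hm i (by omega); omega)
    have h2 : dl * i ≤ dl * (i + 1) := Nat.mul_le_mul_left _ (by omega)
    omega
  · rw [if_neg (by omega), if_neg (by omega)]
    omega

/-- The number of low-order bits. -/
def lowBits (e n m : ℕ) : ℕ := Nat.log 2 ((m - 1) / n / e)

theorem high_lt {e n m : ℕ} (hn : 0 < n) (he : 0 < e) :
    (m - 1) / 2 ^ lowBits e n m < 2 * n * e := by
  have h1 : (m - 1) / n / e < 2 ^ (lowBits e n m + 1) := Nat.lt_pow_succ_log_self (by norm_num) _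
  rw [Nat.div_div_eq_div_mul, Nat.div_lt_iff_lt_mul (by positivity)] at h1
  rw [Nat.div_lt_iff_lt_mul (by positivity)]
  calc m - 1 < _ := h1
    _ = _ := by ring

/-- Together with `high_lt`, the largest high part lies between ne and 2ne. The lower bound limits
the loss in `choose_mul_pow_le`; it may fail for k = 0, where the numbers are not split. -/
theorem le_high {e n m : ℕ} (hn : 0 < n) (he : 0 < e) (hk : 0 < lowBits e n m) :
    n * e ≤ (m - 1) / 2 ^ lowBits e n m := by
  have h0 : (m - 1) / n / e ≠ 0 := by
    intro h0; rw [lowBits, h0] at hk; simp at hk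
  have h1 : 2 ^ lowBits e n m ≤ (m - 1) / n / e := Nat.pow_log_le_self 2 h0
  rw [Nat.div_div_eq_div_mul, Nat.le_div_iff_mul_le (by positivity)] at h1
  rw [Nat.le_div_iff_mul_le (by positivity)]
  linarith

theorem choose_high_le {e n m dl : ℕ} (hn : 0 < n) (hnm : n < m) (he : 2 ≤ e)
    (hdl : dl = 0 ∧ lowBits e n m = 0 ∨ dl = 1 ∧ 0 < lowBits e n m) :
    ((m - 1) / 2 ^ lowBits e n m + 1 + dl * n).choose n * 2 ^ (lowBits e n m * n) ≤
      m.choose n * 2 ^ (8 * n / e + 1) := by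
  rcases hdl with ⟨rfl, hk⟩ | ⟨rfl, hk⟩
  · rw [hk]
    simp only [pow_zero, Nat.div_one, zero_mul, add_zero, mul_one]
    rw [show m - 1 + 1 = m by omega]
    exact Nat.le_mul_of_pos_right _ (by positivity)
  · rw [one_mul, pow_mul]
    exact choose_mul_pow_le he hn (le_high hn (by omega) hk)
      ((Nat.mul_div_le _ _).trans (Nat.sub_le _ _))

theorem Scale.highSeq_le {e L n m k dl : ℕ} (s : Scale e L n) (x : ℕ → ℕ)
    (hk : k = lowBits e n m) (hdl : dl ≤ 1) :
    highSeq x k dl ((m - 1) / 2 ^ k + 1) n (numSuper e n * 2 ^ (2 * e) * (e * e)) ≤ 4 * n * e := by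
  rw [highSeq, if_neg (not_lt.2 s.le_padded), hk]
  have h1 := high_lt (m := m) s.n_pos (show 0 < e by have := s.large; omega)
  have h2 := s.padded_le
  have h3 : dl * n ≤ n := (Nat.mul_le_mul_right n hdl).trans (one_mul n).le
  have h4 : n * 100 ≤ n * e := Nat.mul_le_mul_left _ s.large
  have h5 : 4 * n * e = 4 * (n * e) := by ring
  have h6 : 2 * n * e = 2 * (n * e) := by ring
  omega

theorem Scale.total_le {e L n m k dl : ℕ} {x z : ℕ → ℕ} (s : Scale e L n) (hnm : n < m)
    (hk : k = lowBits e n m) (hdl : dl = 0 ∧ k = 0 ∨ dl = 1 ∧ 0 < k)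
    (hz : StrictMono z) (hzdef : z = highSeq x k dl ((m - 1) / 2 ^ k + 1) n) :
    codeBase (e * e) (2 ^ (2 * e)) (numSuper e n) (4 * e) L k n +
      4 * superPos z (e * e) (2 ^ (2 * e)) (4 * e) L (numSuper e n) ≤
      setBits n m + 50 * n / e := by
  have hzn : z (numSuper e n * 2 ^ (2 * e) * (e * e)) ≤ 4 * n * e := by
    rw [hzdef]; exact s.highSeq_le x hk (by omega)
  have he := s.large
  obtain ⟨y, hy, hle⟩ := four_mul_superPos_le hz (e * e) (2 ^ (2 * e)) (numSuper e n) (4 * e) L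
  have h1 := s.sparse_le (hy.trans hzn)
  have hpow := two_pow_blockSum_le hz (e * e) (numSuper e n * 2 ^ (2 * e))
  have hlp := s.le_padded
  have hpl := s.padded_le'
  have hne := s.mul_e_lt
  set np := numSuper e n * 2 ^ (2 * e) * (e * e) with hnp
  obtain ⟨p, hp⟩ := Nat.exists_eq_add_of_le hlp
  have hznp : z np = (m - 1) / 2 ^ k + 1 + dl * n + p := by
    rw [hzdef, highSeq, if_neg (by omega), hp, Nat.add_sub_cancel_left]
  -- Each padding element costs at most 2L bits, since z is below 2^(2L) up to index np.
  have hch : (z np).choose np ≤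
      ((m - 1) / 2 ^ k + 1 + dl * n).choose n * 2 ^ (2 * L * p) := by
    rw [hznp, hp, pow_mul]
    refine (choose_add_le_mul_pow _ _ _).trans (Nat.mul_le_mul_left _ (Nat.pow_le_pow_left ?_ _))
    rw [← hznp]; omega
  have hhigh := choose_high_le (dl := dl) s.n_pos hnm (show 2 ≤ e by omega) (by rw [← hk]; exact hdl)
  rw [← hk] at hhigh
  have hclog : m.choose n ≤ 2 ^ setBits n m := by
    rw [setBits_eq_clog]; exact Nat.le_pow_clog (by norm_num) _
  have hexp : blockSum z (e * e) (numSuper e n * 2 ^ (2 * e)) + k * n ≤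
      numSuper e n * 2 ^ (2 * e) + 2 * L * p + (8 * n / e + 1) + setBits n m := by
    refine (Nat.pow_le_pow_iff_right (a := 2) (by norm_num)).1 ?_
    rw [pow_add, pow_add, pow_add, pow_add]
    calc 2 ^ blockSum z (e * e) (numSuper e n * 2 ^ (2 * e)) * 2 ^ (k * n)
        ≤ (2 ^ (numSuper e n * 2 ^ (2 * e)) *
            (((m - 1) / 2 ^ k + 1 + dl * n).choose n * 2 ^ (2 * L * p))) * 2 ^ (k * n) :=
          Nat.mul_le_mul_right _ (hpow.trans (Nat.mul_le_mul_left _ hch))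
      _ = 2 ^ (numSuper e n * 2 ^ (2 * e)) * 2 ^ (2 * L * p) *
            (((m - 1) / 2 ^ k + 1 + dl * n).choose n * 2 ^ (k * n)) := by ring
      _ ≤ 2 ^ (numSuper e n * 2 ^ (2 * e)) * 2 ^ (2 * L * p) *
            (2 ^ setBits n m * 2 ^ (8 * n / e + 1)) :=
          Nat.mul_le_mul_left _ (hhigh.trans (Nat.mul_le_mul_right _ hclog))
      _ = _ := by ring
  -- Multiplied by e, the terms are at most 27n for the areas of fixed layout, 2n for rounding block
  -- codes, 2n for rounding superblock codes, n for sparse superblocks, n for padding, 8n for the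
  -- split and n for the final 1: 42n in all, within 50n.
  have hred : lowBase (e * e) (2 ^ (2 * e)) (numSuper e n) (4 * e) L +
      numSuper e n * 2 ^ (2 * e) + 4 * numSuper e n +
      y * (2 * L * (2 ^ (2 * e) * (e * e))) + 2 * L * p + (8 * n / e + 1) ≤ 50 * n / e := by
    rw [Nat.le_div_iff_mul_le (by omega)]
    have g1 := s.lowBase_le
    have g2 := s.numBlocks_le
    have g3 := s.numSuper_le
    have g4 : 2 * L * p * e ≤ n := by
      refine le_trans ?_ s.superblock_le
      have : p ≤ 2 ^ (2 * e) * (e * e) := by omega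
      calc 2 * L * p * e ≤ 2 * L * (2 ^ (2 * e) * (e * e)) * e := by gcongr
        _ = _ := by ring
    have g5 : 8 * n / e * e ≤ 8 * n := Nat.div_mul_le_self _ _
    have g6 : e ≤ n := by
      have := s.e_le
      have := s.le_L
      have := s.le_n
      have := Nat.lt_two_pow_self (n := L)
      omega
    have g7 : 4 * numSuper e n * e ≤ numSuper e n * (6 * L + 4) * e := by
      refine Nat.mul_le_mul_right _ ?_
      rw [mul_comm]
      exact Nat.mul_le_mul_left _ (by omega)
    simp only [Nat.add_mul, one_mul]
    omega
  rw [codeBase]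
  omega

/-! ### The query program -/

namespace WordRAM

namespace Exp

variable {w : ℕ} {M : ℕ → ℕ} {env : List ℕ} {a b : Exp} {x y : ℕ}

theorem val_var {r : ℕ} (h : env.getD r 0 = x) : (var r).val w M env = x := h

theorem val_lit {c : ℕ} (h : c < 2 ^ w) : (lit c).val w M env = c := Nat.mod_eq_of_lt h

theorem val_add (ha : a.val w M env = x) (hb : b.val w M env = y) (h : x + y < 2 ^ w) :
    (bin .add a b).val w M env = x + y := by
  rw [val, ha, hb]; exact Nat.mod_eq_of_lt h

theorem val_mul (ha : a.val w M env = x) (hb : b.val w M env = y) (h : x * y < 2 ^ w) :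
    (bin .mul a b).val w M env = x * y := by
  rw [val, ha, hb]; exact Nat.mod_eq_of_lt h

theorem val_sub (ha : a.val w M env = x) (hb : b.val w M env = y) (hx : x < 2 ^ w) (h : y ≤ x) :
    (bin .sub a b).val w M env = x - y := by
  rw [val, ha, hb, BinOp.natEval, show 2 ^ w - y + x = x - y + 2 ^ w by omega, Nat.add_mod_right]
  exact Nat.mod_eq_of_lt (by omega)

theorem val_div (ha : a.val w M env = x) (hb : b.val w M env = y) :
    (bin .div a b).val w M env = x / y := by
  rw [val, ha, hb]; rfl

theorem val_mod (ha : a.val w M env = x) (hb : b.val w M env = y) :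
    (bin .mod a b).val w M env = x % y := by
  rw [val, ha, hb]; rfl

theorem val_shl (ha : a.val w M env = x) (hb : b.val w M env = y) (h : x * 2 ^ y < 2 ^ w) :
    (bin .shl a b).val w M env = x * 2 ^ y := by
  rw [val, ha, hb, BinOp.natEval, Nat.shiftLeft_eq]; exact Nat.mod_eq_of_lt h

theorem val_msb (ha : a.val w M env = x) (h : x < 2 ^ w) :
    (msb a).val w M env = Nat.log 2 x := by
  rw [val, ha]
  exact Nat.mod_eq_of_lt ((Nat.log_le_self 2 x).trans_lt h)

/-- Positions up to 2 · 2^w occur because the string may be longer than 2^w bits; division by w ≥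
100 brings the word address back into range. -/
theorem val_read_of_le {u g r l : Exp} {X a' u' g' r' l' v p : ℕ} (hw : 100 ≤ w)
    (hW : env.getD 3 0 = w) (hM : ∀ b < 2 ^ w, M b = X / 2 ^ (b * w) % 2 ^ w)
    (ha : a.val w M env = a') (hu : u.val w M env = u') (hg : g.val w M env = g')
    (hr : r.val w M env = r') (hl : l.val w M env = l') (hg' : g' ≤ 2 * w) (hr' : 4 * r' ≤ 2 ^ w)
    (hp : a' + u' * g' + r' = p) (hp' : p ≤ 2 * 2 ^ w) (hv : X / 2 ^ p % 2 ^ l' = v)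
    (hv' : v < 2 ^ w) : (read a u g r l).val w M env = v := by
  have h1 : 8 * w * w ≤ 2 ^ w := by
    have := pow_growth hw
    have h2 : w * w ≤ w ^ 4 := by
      calc w * w = w ^ 2 := by ring
        _ ≤ w ^ 4 := Nat.pow_le_pow_right (by omega) (by norm_num)
    have h3 : 8 * w * w = 8 * (w * w) := by ring
    omega
  have h2 : w * g' ≤ w * (2 * w) := Nat.mul_le_mul_left _ hg'
  have h3 : w * (2 * w) = 2 * (w * w) := by ring
  have h4 : 8 * w * w = 8 * (w * w) := by ring
  have h5 : w ≤ w * w := Nat.le_mul_of_pos_left _ (by omega)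
  rw [val_read (by omega) hW hM ha hu hg hr hl (by omega), hp, hv, Nat.mod_eq_of_lt hv']
  rw [hp]
  have h6 : p / w ≤ 2 * 2 ^ w / 100 :=
    (Nat.div_le_div_right hp').trans (Nat.div_le_div_left hw (by norm_num))
  have h7 : 100 < 2 ^ w := (by omega : 100 ≤ w).trans_lt Nat.lt_two_pow_self
  omega

end Exp

theorem Code.val_bind {w : ℕ} {M : ℕ → ℕ} {env : List ℕ} {e : Exp} {k : Code} {v x : ℕ}
    (he : e.val w M env = v) (hk : k.val w M (env ++ [v]) = x) : (bind e k).val w M env = x := by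
  rw [val, he, hk]

open Exp

/-- Twice the value of register `6`. -/
abbrev twoL : Exp := bin .mul (lit 2) (var 6)

/-- Field `f` of the record of the block of the query. -/
abbrev blockField (f : ℕ) : Exp :=
  read (var 16) (bin .add (bin .mul (lit 3) (var 12)) (lit f)) (var 9) (lit 0) (var 9)

/-- Field `f` of the record of the superblock of the query. -/
abbrev superField (f : ℕ) : Exp :=
  read (var 17) (bin .add (bin .mul (lit 3) (var 14)) (lit f)) twoL (lit 0) twoL

/-- Combines the high-order part in register `r` with the low-order bits. -/
abbrev combine (r : ℕ) : Code :=
  Code.ret (bin .add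
    -- Register 11 holds k. As 0 / 0 = 0 on this machine, k / k is the factor `dl` with which the
    -- index was added.
    (bin .shl (bin .sub (var r) (bin .mul (bin .div (var 11) (var 11)) (var 4))) (var 11))
    (read (var 18) (var 4) (var 11) (lit 0) (var 11)))

/-- The lookup, once the parameters are in the registers. -/
def lookupCode : Code :=
  -- Register 20 receives the position of the superblock code. In a sparse superblock 21 receives
  -- the high part; otherwise 21 to 24 receive the span, the offset, the code and the high part.
  Code.bind (superField 1) <|
  Code.ite (lit 0) (superField 2)
    (Code.bind (read (var 19) (var 20) (lit 4)
      (bin .mul (bin .mod (var 4) (bin .mul (var 8) (var 13))) twoL) twoL) (combine 21))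
    (Code.bind (blockField 1) <|
     Code.bind (blockField 2) <|
     Code.bind (read (var 19) (var 20) (lit 4) (var 22) (var 10)) <|
     Code.bind (bin .add (bin .add (superField 0) (blockField 0))
      (read (lit 0) (bin .add
        (bin .mul (bin .add (bin .shl (var 21) (var 10)) (var 23)) (var 8))
        (bin .mod (var 4) (var 8))) (var 9) (lit 0) (var 9)))
      (combine 24))

/-- The query for large sets. -/
def largeCode : Code :=
  -- Registers 4 to 7 hold i - 1, m - 1, L and e. Registers 8 to 19 receive, in this order: block
  -- size, local field width, maximal code length, k, block index, blocks per superblock, superblock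
  -- index, number of superblocks, and the starts of block records, superblock records, low bits and
  -- codes.
  Code.bind (bin .mul (var 7) (var 7)) <|
  Code.bind (bin .mul (lit 4) (var 7)) <|
  Code.bind (bin .mul (var 9) (var 8)) <|
  Code.bind (msb (bin .div (bin .div (var 5) (var 1)) (var 7))) <|
  Code.bind (bin .div (var 4) (var 8)) <|
  Code.bind (bin .shl (lit 1) (bin .mul (lit 2) (var 7))) <|
  Code.bind (bin .div (var 12) (var 13)) <|
  Code.bind (bin .add (bin .div (var 1) (bin .mul (var 8) (var 13))) (lit 1)) <|
  Code.bind (bin .mul (var 9) (bin .mul (bin .shl (lit 1) (bin .add (var 9) (var 10))) (var 8))) <|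
  Code.bind (bin .add (var 16) (bin .mul (var 9) (bin .mul (lit 3) (bin .mul (var 15) (var 13))))) <|
  Code.bind (bin .add (var 17) (bin .mul twoL (bin .mul (lit 3) (var 15)))) <|
  Code.bind (bin .add (var 18) (bin .mul (var 11) (var 1))) <|
  lookupCode

/-- The query for small sets. -/
def smallCode : Code :=
  -- The shift by 3 tests w ≥ 8. On shorter words each element occupies a whole word.
  Code.ite (lit 0) (bin .shr (var 3) (lit 3))
    (Code.ret (read (lit 0) (var 4) (bin .add (msb (var 5)) (lit 1)) (lit 0)
      (bin .add (msb (var 5)) (lit 1))))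
    (Code.ret (load (var 4)))

/-- The query program. -/
def queryCode : Code :=
  Code.bind (bin .sub (var 0) (lit 1)) <|
  Code.bind (bin .sub (var 2) (lit 1)) <|
  Code.bind (msb (var 1)) <|
  Code.bind (msb (var 6)) <|
  -- Predecessors are compared because n and m may be 2^w, which a register holds as 0. The shift by
  -- 7 tests e ≥ 128; a literal of that size would be truncated on short words.
  Code.ite (bin .sub (var 1) (lit 1)) (var 5) (Code.ite (lit 0) (bin .shr (var 7) (lit 7)) largeCode smallCode)
    (Code.ret (var 4))

theorem queryCode_below : queryCode.Below 4 = true := by rfl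

theorem Exp.length_code (e : Exp) (d d' : ℕ) : (e.code d).length = (e.code d').length := by
  induction e generalizing d d' with
  | var r => rfl
  | lit c => rfl
  | bin o a b iha ihb => simp [code, iha d d', ihb (d + 1) (d' + 1)]
  | msb a iha => simp [code, iha d d']
  | load a iha => simp [code, iha d d']

/-- Jump targets do not affect the length, so the exit address can be the program's own length. -/
theorem Code.length_code (c : Code) (H H' d s s' : ℕ) :
    (c.code H d s).length = (c.code H' d s').length := by
  induction c generalizing d s s' with
  | ret e => simp [code]
  | bind e k ih => simp only [code, List.length_append]; rw [ih]
  | ite a b p q ihp ihq =>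
    simp only [code, List.length_append, List.length_singleton]
    exact congrArg₂ (· + ·) (congrArg (_ + ·) (ihq _ _ _)) (ihp _ _ _)

/-- The compiled query program. -/
def queryProgram : Program := queryCode.code (queryCode.code 0 4 0).length 4 0

theorem queryProgram_computesIn {w i n m X l x : ℕ} (hX : X < 2 ^ l)
    (hx : queryCode.val w (fun a => X / 2 ^ (a * w) % 2 ^ w)
      [i % 2 ^ w, n % 2 ^ w, m % 2 ^ w, w] = x) :
    ComputesIn queryProgram (memory w (bitList X l)) (queryRegs w i n m) queryProgram.length x := by
  rw [← hx]
  refine Code.computesIn (env := [i % 2 ^ w, n % 2 ^ w, m % 2 ^ w, w]) (fun a => toNat_memory hX a)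
    queryCode_below ?_ (Code.length_code _ _ _ _ _ _).le
  intro r hr
  have hww : w < 2 ^ w := Nat.lt_two_pow_self
  simp only [List.length_cons, List.length_nil] at hr
  interval_cases r <;> simp [queryRegs, Nat.mod_eq_of_lt hww]

end WordRAM

/-! ### Correctness of the query program -/

open WordRAM WordRAM.Exp

/-- The tail of the query: from the high-order part to the answer. -/
theorem val_combine {w X L e b c sg h k J q Q A1 A2 A3 A4 i n m m₁ : ℕ} {ys : List ℕ} {r dl x : ℕ}
    (hw : 100 ≤ w) (hk : k ≤ w)
    (hA : A3 + k * i ≤ 2 * 2 ^ w)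
    (hr : ([i + 1, n, m, w, i, m₁, L, e, b, sg, h, k, J, c, q, Q, A1, A2, A3, A4] ++ ys).getD r 0
      = x / 2 ^ k + dl * i)
    (hdl : dl = 0 ∧ k = 0 ∨ dl = 1 ∧ 0 < k) (hz : x / 2 ^ k + dl * i < 2 ^ w) (hx : x < 2 ^ w)
    (hlow : X / 2 ^ (A3 + k * i) % 2 ^ k = x % 2 ^ k) :
    (combine r).val w (fun a => X / 2 ^ (a * w) % 2 ^ w)
      ([i + 1, n, m, w, i, m₁, L, e, b, sg, h, k, J, c, q, Q, A1, A2, A3, A4] ++ ys) = x := by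
  have hkk : k / k = dl := by
    rcases hdl with ⟨rfl, rfl⟩ | ⟨rfl, hk⟩
    · rfl
    · exact Nat.div_self hk
  have hsplit : x / 2 ^ k * 2 ^ k + x % 2 ^ k = x := Nat.div_add_mod' _ _
  have hdi : dl * i ≤ x / 2 ^ k + dl * i := Nat.le_add_left _ _
  have hlowlt : x % 2 ^ k < 2 ^ w := (Nat.mod_le _ _).trans_lt hx
  have hfin : x / 2 ^ k * 2 ^ k + x % 2 ^ k < 2 ^ w := by rw [hsplit]; exact hx
  have h1 : (read (var 18) (var 4) (var 11) (lit 0) (var 11)).val w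
      (fun a => X / 2 ^ (a * w) % 2 ^ w)
      ([i + 1, n, m, w, i, m₁, L, e, b, sg, h, k, J, c, q, Q, A1, A2, A3, A4] ++ ys)
      = x % 2 ^ k :=
    val_read_of_le hw rfl (fun _ _ => rfl) (val_var (x := A3) rfl) (val_var (x := i) rfl) (val_var (x := k) rfl)
      (val_lit (by positivity)) (val_var (x := k) rfl) (by omega) (by omega)
      (show A3 + i * k + 0 = A3 + k * i by ring) hA hlow hlowlt
  have hsub : x / 2 ^ k + dl * i - k / k * i = x / 2 ^ k := by
    rw [hkk]; exact Nat.add_sub_cancel _ _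
  have hx2 : x / 2 ^ k * 2 ^ k < 2 ^ w := (Nat.div_mul_le_self _ _).trans_lt hx
  calc _ = x / 2 ^ k * 2 ^ k + x % 2 ^ k :=
        val_add (val_shl ((val_sub (val_var hr) (val_mul (val_div (val_var (x := k) rfl) (val_var (x := k) rfl))
          (val_var (x := i) rfl) (by rw [hkk]; omega)) hz (by rw [hkk]; exact hdi)).trans hsub)
          (val_var (x := k) rfl) hx2) h1 hfin
    _ = x := hsplit

/-- The size hypotheses ensure that no arithmetic operation wraps around. A field of 2L bits may be
wider than a word, but the values read from such fields are below 2^w. -/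
theorem val_lookupCode {w X L e b c sg k Q i n m m₁ dl x : ℕ} {z : ℕ → ℕ}
    (hw : 100 ≤ w) (hb : 0 < b) (hc : 0 < c) (hsg : 0 < sg) (hL : 0 < L)
    (hLw : L ≤ w) (hsgw : sg ≤ w) (hkw : k ≤ w) (hi : i < n) (hnw : n < 2 ^ w)
    (hin : i < Q * c * b)
    (hbc : 4 * (b * c * (2 * L)) ≤ 2 ^ w) (hsg4 : 4 * 2 ^ sg ≤ 2 ^ w)
    (hcode : codeBase b c Q sg L k n < 2 ^ w)
    (htot : codeBase b c Q sg L k n + 4 * superPos z b c sg L Q ≤ 2 * 2 ^ w)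
    (hdl : dl = 0 ∧ k = 0 ∨ dl = 1 ∧ 0 < k)
    (hzi : z i = x / 2 ^ k + dl * i) (hziw : z i < 2 ^ w) (hx : x < 2 ^ w)
    (hlow : X / 2 ^ (lowBase b c Q sg L + k * i) % 2 ^ k = x % 2 ^ k)
    (hhigh : ReadsHigh z b c Q sg L k n X i) :
    lookupCode.val w (fun a => X / 2 ^ (a * w) % 2 ^ w)
      [i + 1, n, m, w, i, m₁, L, e, b, sg, sg * b, k, i / b, c, i / b / c, Q, tableBits b sg,
        superBase b c Q sg, lowBase b c Q sg L, codeBase b c Q sg L k n] = x := by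
  obtain ⟨U, fl, zs, hzs, hU, hfl, hUle, hcase⟩ := hhigh
  have hiw : i < 2 ^ w := hi.trans hnw
  have hJ : i / b < Q * c := (Nat.div_lt_iff_lt_mul hb).2 hin
  have hq : i / b / c < Q := (Nat.div_lt_iff_lt_mul hc).2 hJ
  have hA1 : tableBits b sg ≤ superBase b c Q sg := Nat.le_add_right _ _
  have hA2 : superBase b c Q sg ≤ lowBase b c Q sg L := Nat.le_add_right _ _
  have hA3 : lowBase b c Q sg L ≤ codeBase b c Q sg L k n := Nat.le_add_right _ _
  have hA2' : 3 * (Q * c) ≤ superBase b c Q sg :=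
    (Nat.le_mul_of_pos_left _ hsg).trans (Nat.le_add_left _ _)
  have hA3' : 3 * Q ≤ lowBase b c Q sg L :=
    (Nat.le_mul_of_pos_left _ (by omega)).trans (Nat.le_add_left _ _)
  have hA4 : lowBase b c Q sg L + k * i ≤ codeBase b c Q sg L k n :=
    Nat.add_le_add_left (Nat.mul_le_mul_left _ hi.le) _
  have hblock : ∀ f < 3, tableBits b sg + sg * (3 * (i / b) + f) ≤ superBase b c Q sg :=
    fun f hf => Nat.add_le_add_left (Nat.mul_le_mul_left _ (by omega)) _
  have hsuper : ∀ f < 3, superBase b c Q sg + 2 * L * (3 * (i / b / c) + f) ≤ lowBase b c Q sg L :=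
    fun f hf => Nat.add_le_add_left (Nat.mul_le_mul_left _ (by omega)) _
  have h4w : 4 < 2 ^ w := (by omega : 4 < w).trans Nat.lt_two_pow_self
  have hwlt : w < 2 ^ w := Nat.lt_two_pow_self
  have hUw : U < 2 ^ w := by omega
  have hLw2 : 2 * L < 2 ^ w := by
    have h1 : 1 ≤ b * c := Nat.mul_pos hb hc
    have h2 : 2 * L ≤ b * c * (2 * L) := Nat.le_mul_of_pos_left _ h1
    omega
  have hsuperField : ∀ (ys : List ℕ) (f v : ℕ), f < 3 → v < 2 ^ w →
      X / 2 ^ (superBase b c Q sg + 2 * L * (3 * (i / b / c) + f)) % 2 ^ (2 * L) = v →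
      (superField f).val w (fun a => X / 2 ^ (a * w) % 2 ^ w)
        ([i + 1, n, m, w, i, m₁, L, e, b, sg, sg * b, k, i / b, c, i / b / c, Q, tableBits b sg,
          superBase b c Q sg, lowBase b c Q sg L, codeBase b c Q sg L k n] ++ ys) = v := by
    intro ys f v hf hv hread
    have h1 := hsuper f hf
    exact val_read_of_le hw rfl (fun _ _ => rfl) (val_var (x := superBase b c Q sg) rfl)
      (val_add (val_mul (val_lit (by omega)) (val_var (x := i / b / c) rfl) (by omega)) (val_lit (by omega))
        (by omega))
      (val_mul (val_lit (by omega)) (val_var (x := L) rfl) hLw2) (val_lit (by omega))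
      (val_mul (val_lit (by omega)) (val_var (x := L) rfl) hLw2) (by omega) (by omega)
      (show _ = superBase b c Q sg + 2 * L * (3 * (i / b / c) + f) by ring) (by omega) hread hv
  have hblockField : ∀ (ys : List ℕ) (f v : ℕ), f < 3 → v < 2 ^ w →
      X / 2 ^ (tableBits b sg + sg * (3 * (i / b) + f)) % 2 ^ sg = v →
      (blockField f).val w (fun a => X / 2 ^ (a * w) % 2 ^ w)
        ([i + 1, n, m, w, i, m₁, L, e, b, sg, sg * b, k, i / b, c, i / b / c, Q, tableBits b sg,
          superBase b c Q sg, lowBase b c Q sg L, codeBase b c Q sg L k n] ++ ys) = v := by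
    intro ys f v hf hv hread
    have h1 := hblock f hf
    exact val_read_of_le hw rfl (fun _ _ => rfl) (val_var (x := tableBits b sg) rfl)
      (val_add (val_mul (val_lit (by omega)) (val_var (x := i / b) rfl) (by omega)) (val_lit (by omega))
        (by omega))
      (val_var (x := sg) rfl) (val_lit (by omega)) (val_var (x := sg) rfl) (by omega) (by omega)
      (show _ = tableBits b sg + sg * (3 * (i / b) + f) by ring) (by omega) hread hv
  refine Code.val_bind (v := U) (by simpa using hsuperField [] 1 U (by norm_num) hUw hU) ?_
  have hbcle : b * c ≤ b * c * (2 * L) := Nat.le_mul_of_pos_right _ (by omega)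
  rw [Code.val]
  rcases hcase with ⟨rfl, hread, hpos⟩ | ⟨rfl, rz, s, rp, hrz, hs, hrp, hpos, hread⟩
  · rw [val_lit (by omega), hsuperField [U] 2 1 (by norm_num) (by omega) hfl, if_pos one_pos]
    have hmod : i % (b * c) < b * c := Nat.mod_lt _ (Nat.mul_pos hb hc)
    have hmod2 : i % (b * c) * (2 * L) ≤ b * c * (2 * L) := Nat.mul_le_mul_right _ hmod.le
    refine Code.val_bind (v := z i) ?_ ?_
    · exact val_read_of_le hw rfl (fun _ _ => rfl) (val_var (x := codeBase b c Q sg L k n) rfl) (val_var (x := U) rfl)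
        (val_lit h4w)
        (val_mul (val_mod (val_var (x := i) rfl) (val_mul (val_var (x := b) rfl) (val_var (x := c) rfl) (by omega)))
          (val_mul (val_lit (by omega)) (val_var (x := L) rfl) hLw2) (by omega))
        (val_mul (val_lit (by omega)) (val_var (x := L) rfl) hLw2) (by omega) (by omega) rfl (by omega)
        hread hziw
    · exact val_combine (ys := [U, z i]) hw hkw (by omega) hzi hdl (hzi ▸ hziw) hx hlow
  · rw [val_lit (by omega), hsuperField [U] 2 0 (by norm_num) (by omega) hfl,
      if_neg (lt_irrefl 0)]
    have hslt : s < 2 ^ sg := by rw [← hs]; exact Nat.mod_lt _ (by positivity)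
    have hrzlt : rz < 2 ^ sg := by rw [← hrz]; exact Nat.mod_lt _ (by positivity)
    have hrplt : rp < 2 ^ sg := by rw [← hrp]; exact Nat.mod_lt _ (by positivity)
    obtain ⟨v, hv⟩ : ∃ v, X / 2 ^ (codeBase b c Q sg L k n + U * 4 + rp) % 2 ^ (sg * b) = v :=
      ⟨_, rfl⟩
    have hvlt : v < 2 ^ (sg * b) := by rw [← hv]; exact Nat.mod_lt _ (by positivity)
    have hsum := hread v hv
    set y := X / 2 ^ (sg * ((s * 2 ^ (sg * b) + v) * b + i % b)) % 2 ^ sg with hy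
    have hib : i % b < b := Nat.mod_lt _ hb
    have hs1 : s * 2 ^ (sg * b) + v < 2 ^ (sg + sg * b) := by
      rw [pow_add]
      calc s * 2 ^ (sg * b) + v < (s + 1) * 2 ^ (sg * b) := by rw [Nat.succ_mul]; omega
        _ ≤ _ := Nat.mul_le_mul_right _ hslt
    have hs2 : (s * 2 ^ (sg * b) + v) * b + i % b < 2 ^ (sg + sg * b) * b := by
      calc _ < (s * 2 ^ (sg * b) + v + 1) * b := by rw [Nat.succ_mul]; omega
        _ ≤ _ := Nat.mul_le_mul_right _ hs1
    have ht1 : 2 ^ (sg + sg * b) * b ≤ tableBits b sg := Nat.le_mul_of_pos_left _ hsg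
    have ht2 : 2 ^ (sg + sg * b) ≤ 2 ^ (sg + sg * b) * b := Nat.le_mul_of_pos_right _ hb
    have ht3 : 2 ^ (sg * b) ≤ 2 ^ (sg + sg * b) :=
      Nat.pow_le_pow_right (by norm_num) (Nat.le_add_left _ _)
    have hs3 : (s * 2 ^ (sg * b) + v) * b ≤ (s * 2 ^ (sg * b) + v) * b + i % b :=
      Nat.le_add_right _ _
    have hspos : sg * ((s * 2 ^ (sg * b) + v) * b + i % b) ≤ tableBits b sg :=
      Nat.mul_le_mul_left _ hs2.le
    refine Code.val_bind (v := s) (hblockField [U] 1 s (by norm_num) (by omega) hs) ?_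
    refine Code.val_bind (v := rp) (hblockField [U, s] 2 rp (by norm_num) (by omega) hrp) ?_
    refine Code.val_bind (v := v) ?_ ?_
    · exact val_read_of_le hw rfl (fun _ _ => rfl) (val_var (x := codeBase b c Q sg L k n) rfl) (val_var (x := U) rfl)
        (val_lit h4w) (val_var (x := rp) rfl) (val_var (x := sg * b) rfl) (by omega) (by omega) rfl (by omega) hv (by omega)
    refine Code.val_bind (v := z i) ?_ ?_
    · refine (val_add (val_add (hsuperField [U, s, rp, v] 0 zs (by norm_num) (by omega) hzs)
        (hblockField [U, s, rp, v] 0 rz (by norm_num) (by omega) hrz) (by omega))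
        (val_read_of_le (v := y) hw rfl (fun _ _ => rfl) (val_lit (by omega))
          (val_add (val_mul (val_add (val_shl (val_var (x := s) rfl) (val_var (x := sg * b) rfl)
            (show s * 2 ^ (sg * b) < 2 ^ w by omega)) (val_var (x := v) rfl)
            (show s * 2 ^ (sg * b) + v < 2 ^ w by omega)) (val_var (x := b) rfl) (by omega))
            (val_mod (val_var (x := i) rfl) (val_var (x := b) rfl)) (by omega))
          (val_var (x := sg) rfl) (val_lit (by omega)) (val_var (x := sg) rfl) (by omega) (by omega)
          (show _ = sg * ((s * 2 ^ (sg * b) + v) * b + i % b) by ring) (by omega) rfl (by omega))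
        (by omega)).trans hsum
    · exact val_combine (ys := [U, s, rp, v, z i]) hw hkw (by omega) hzi hdl (hzi ▸ hziw) hx hlow

theorem val_largeCode {w X L e k n m m₂ i dl x : ℕ} {z : ℕ → ℕ} (s : Scale e L n) (hnm : n < m)
    (hmw : m ≤ 2 ^ w) (hi : i < n) (hk : k = lowBits e n m)
    (hdl : dl = 0 ∧ k = 0 ∨ dl = 1 ∧ 0 < k)
    (hzi : z i = x / 2 ^ k + dl * i) (hx : x < m)
    (htot : codeBase (e * e) (2 ^ (2 * e)) (numSuper e n) (4 * e) L k n +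
      4 * superPos z (e * e) (2 ^ (2 * e)) (4 * e) L (numSuper e n) ≤ 2 * 2 ^ w)
    (hlow : X / 2 ^ (lowBase (e * e) (2 ^ (2 * e)) (numSuper e n) (4 * e) L + k * i) % 2 ^ k
      = x % 2 ^ k)
    (hhigh : ReadsHigh z (e * e) (2 ^ (2 * e)) (numSuper e n) (4 * e) L k n X i) :
    largeCode.val w (fun a => X / 2 ^ (a * w) % 2 ^ w) [i + 1, n, m₂, w, i, m - 1, L, e] = x := by
  have he := s.large
  have hLw : L < w := (Nat.pow_lt_pow_iff_right (a := 2) (by norm_num)).1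
    (s.le_n.trans_lt (hnm.trans_le hmw))
  have heL : e < L := Nat.lt_two_pow_self.trans_le s.le_L
  have hw : 100 ≤ w := by omega
  have hnw : n < 2 ^ w := hnm.trans_le hmw
  have hwlt : w < 2 ^ w := Nat.lt_two_pow_self
  have hlb : lowBase (e * e) (2 ^ (2 * e)) (numSuper e n) (4 * e) L * 3 ≤ n := by
    have h1 := s.lowBase_le
    have h2 := Nat.mul_le_mul_left (lowBase (e * e) (2 ^ (2 * e)) (numSuper e n) (4 * e) L) he
    omega
  -- For k > 0 the choice of k gives n · e · 2^k ≤ m - 1, which leaves ample room.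
  have hkn : 3 * (k * n) < 2 ^ w ∧ (0 < k → n * 3 < m) := by
    rcases Nat.eq_zero_or_pos k with h0 | h0
    · rw [h0]; simp
    · have h1 := le_high (m := m) s.n_pos (show 0 < e by omega) (hk ▸ h0)
      rw [← hk, Nat.le_div_iff_mul_le (by positivity)] at h1
      have h2 : k ≤ 2 ^ k := Nat.lt_two_pow_self.le
      have h3 : 3 * (k * n) ≤ n * e * 2 ^ k := by
        calc 3 * (k * n) ≤ e * (2 ^ k * n) := by gcongr; omega
          _ = _ := by ring
      have h4 : n * 3 ≤ n * e * 2 ^ k := by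
        calc n * 3 ≤ n * e := Nat.mul_le_mul_left _ (by omega)
          _ ≤ _ := Nat.le_mul_of_pos_right _ (by positivity)
      exact ⟨by omega, fun _ => by omega⟩
  have hkw : k ≤ w := by
    have := hkn.1
    have h1 : (m - 1) / n / e ≤ m - 1 := (Nat.div_le_self _ _).trans (Nat.div_le_self _ _)
    rw [hk, lowBits]
    refine (Nat.log_mono_right (show (m - 1) / n / e ≤ 2 ^ w by omega)).trans ?_
    rw [Nat.log_pow (by norm_num)]
  have hxw : x < 2 ^ w := hx.trans_le hmw
  -- With low bits present, the high part is at most x/2 + n, and n < m/3.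
  have hziw : z i < 2 ^ w := by
    rw [hzi]
    rcases hdl with ⟨rfl, hk0⟩ | ⟨rfl, hk0⟩
    · rw [hk0]; simpa using hxw
    · have h1 := hkn.2 hk0
      have h2 : x / 2 ^ k ≤ x / 2 := Nat.div_le_div_left (by
        calc 2 = 2 ^ 1 := rfl
          _ ≤ _ := Nat.pow_le_pow_right (by norm_num) hk0) (by norm_num)
      omega
  have hbc : 4 * (e * e * 2 ^ (2 * e) * (2 * L)) ≤ 2 ^ w := by
    have h1 := s.superblock_le
    have h2 : 2 ^ (2 * e) * (e * e) * (2 * L) * 4 ≤ 2 ^ (2 * e) * (e * e) * (2 * L) * e :=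
      Nat.mul_le_mul_left _ (by omega)
    have h3 : 4 * (e * e * 2 ^ (2 * e) * (2 * L)) = 2 ^ (2 * e) * (e * e) * (2 * L) * 4 := by ring
    omega
  have hsg4 : 4 * 2 ^ (4 * e) ≤ 2 ^ w := by
    have h1 := s.two_pow_le (x := 4 * e + 2) (by
      have := Nat.zero_le (e ^ 4); have := Nat.zero_le (e ^ 3); omega)
    rw [pow_add] at h1
    omega
  have hb : 0 < e * e := Nat.mul_pos (by omega) (by omega)
  have hc : 0 < 2 ^ (2 * e) := by positivity
  have hcb : codeBase (e * e) (2 ^ (2 * e)) (numSuper e n) (4 * e) L k n < 2 ^ w := by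
    have := hkn.1
    rw [codeBase]; omega
  have hres := val_lookupCode (m := m₂) (e := e) (m₁ := m - 1) hw hb hc
    (show 0 < 4 * e by omega) s.L_pos hLw.le
    (show 4 * e ≤ w by
      have := pow_growth he
      have := s.le_L
      have := Nat.zero_le (e ^ 4); have := Nat.zero_le (e ^ 3)
      omega)
    hkw hi hnw (hi.trans_le s.le_padded) hbc hsg4 hcb htot hdl hzi hziw hxw hlow hhigh
  -- sizes of the intermediate results
  have hQ : 0 < numSuper e n := Nat.succ_pos _
  have hA1 : tableBits (e * e) (4 * e) ≤ superBase (e * e) (2 ^ (2 * e)) (numSuper e n) (4 * e) :=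
    Nat.le_add_right _ _
  have hA2 : superBase (e * e) (2 ^ (2 * e)) (numSuper e n) (4 * e) ≤
      lowBase (e * e) (2 ^ (2 * e)) (numSuper e n) (4 * e) L := Nat.le_add_right _ _
  have hA2' : 4 * e * (3 * (numSuper e n * 2 ^ (2 * e))) ≤
      superBase (e * e) (2 ^ (2 * e)) (numSuper e n) (4 * e) := Nat.le_add_left _ _
  have hA3' : 2 * L * (3 * numSuper e n) ≤
      lowBase (e * e) (2 ^ (2 * e)) (numSuper e n) (4 * e) L := Nat.le_add_left _ _
  have hA4' : k * n ≤ codeBase (e * e) (2 ^ (2 * e)) (numSuper e n) (4 * e) L k n :=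
    Nat.le_add_left _ _
  have q1 : 3 * (numSuper e n * 2 ^ (2 * e)) ≤ 4 * e * (3 * (numSuper e n * 2 ^ (2 * e))) :=
    Nat.le_mul_of_pos_left _ (by omega)
  have q2 : 2 ^ (2 * e) ≤ numSuper e n * 2 ^ (2 * e) := Nat.le_mul_of_pos_left _ hQ
  have q3 : 3 * numSuper e n ≤ 2 * L * (3 * numSuper e n) := Nat.le_mul_of_pos_left _ (by omega)
  have q4 : 2 * L ≤ 2 * L * (3 * numSuper e n) := Nat.le_mul_of_pos_right _ (by omega)
  have t1 : 2 ^ (4 * e + 4 * e * (e * e)) * (e * e) ≤ tableBits (e * e) (4 * e) :=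
    Nat.le_mul_of_pos_left _ (by omega)
  have t2 : 2 ^ (4 * e + 4 * e * (e * e)) ≤ 2 ^ (4 * e + 4 * e * (e * e)) * (e * e) :=
    Nat.le_mul_of_pos_right _ hb
  have t3 : 4 * e + 4 * e * (e * e) < 2 ^ (4 * e + 4 * e * (e * e)) := Nat.lt_two_pow_self
  have t4 : e * e ≤ 4 * e * (e * e) := Nat.le_mul_of_pos_left _ (by omega)
  have c1 : e * e * 2 ^ (2 * e) ≤ e * e * 2 ^ (2 * e) * (2 * L) :=
    Nat.le_mul_of_pos_right _ (by omega)
  have hTab : tableBits (e * e) (4 * e) < 2 ^ w := by omega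
  have n3 : 3 < 2 ^ w := by omega
  have n1 : 1 < 2 ^ w := by omega
  have n2 : 2 < 2 ^ w := by omega
  have n4 : 4 < 2 ^ w := by omega
  refine Code.val_bind (v := e * e) (val_mul (val_var (x := e) rfl) (val_var (x := e) rfl)
    (by omega)) ?_
  refine Code.val_bind (v := 4 * e) (val_mul (val_lit n4) (val_var (x := e) rfl) (by omega)) ?_
  refine Code.val_bind (v := 4 * e * (e * e)) (val_mul (val_var (x := 4 * e) rfl)
    (val_var (x := e * e) rfl) (by omega)) ?_
  refine Code.val_bind (v := k) ((val_msb (val_div (val_div (val_var (x := m - 1) rfl)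
    (val_var (x := n) rfl)) (val_var (x := e) rfl)) ?_).trans hk.symm) ?_
  · have h1 : (m - 1) / n / e ≤ m - 1 := (Nat.div_le_self _ _).trans (Nat.div_le_self _ _)
    omega
  refine Code.val_bind (v := i / (e * e)) (val_div (val_var (x := i) rfl)
    (val_var (x := e * e) rfl)) ?_
  refine Code.val_bind (v := 2 ^ (2 * e)) ((val_shl (val_lit n1) (val_mul (val_lit n2)
    (val_var (x := e) rfl) (by omega)) (by omega)).trans (one_mul _)) ?_
  refine Code.val_bind (v := i / (e * e) / 2 ^ (2 * e)) (val_div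
    (val_var (x := i / (e * e)) rfl) (val_var (x := 2 ^ (2 * e)) rfl)) ?_
  refine Code.val_bind (v := numSuper e n) (val_add (val_div (val_var (x := n) rfl)
    (val_mul (val_var (x := e * e) rfl) (val_var (x := 2 ^ (2 * e)) rfl) (by omega)))
    (val_lit n1) (show numSuper e n < 2 ^ w by omega)) ?_
  refine Code.val_bind (v := tableBits (e * e) (4 * e)) (val_mul (val_var (x := 4 * e) rfl)
    (val_mul ((val_shl (val_lit n1) (val_add (val_var (x := 4 * e) rfl)
      (val_var (x := 4 * e * (e * e)) rfl) (by omega)) (by omega)).trans (one_mul _))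
      (val_var (x := e * e) rfl) (by omega)) hTab) ?_
  refine Code.val_bind (v := superBase (e * e) (2 ^ (2 * e)) (numSuper e n) (4 * e))
    (val_add (val_var (x := tableBits (e * e) (4 * e)) rfl) (val_mul (val_var (x := 4 * e) rfl)
      (val_mul (val_lit n3) (val_mul (val_var (x := numSuper e n) rfl)
        (val_var (x := 2 ^ (2 * e)) rfl) (by omega)) (by omega)) (by omega))
      (show superBase (e * e) (2 ^ (2 * e)) (numSuper e n) (4 * e) < 2 ^ w by omega)) ?_
  refine Code.val_bind (v := lowBase (e * e) (2 ^ (2 * e)) (numSuper e n) (4 * e) L)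
    (val_add (val_var (x := superBase (e * e) (2 ^ (2 * e)) (numSuper e n) (4 * e)) rfl)
      (val_mul (val_mul (val_lit n2) (val_var (x := L) rfl) (by omega))
        (val_mul (val_lit n3) (val_var (x := numSuper e n) rfl) (by omega)) (by omega))
      (show lowBase (e * e) (2 ^ (2 * e)) (numSuper e n) (4 * e) L < 2 ^ w by omega)) ?_
  refine Code.val_bind (v := codeBase (e * e) (2 ^ (2 * e)) (numSuper e n) (4 * e) L k n)
    (val_add (val_var (x := lowBase (e * e) (2 ^ (2 * e)) (numSuper e n) (4 * e) L) rfl)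
      (val_mul (val_var (x := k) rfl) (val_var (x := n) rfl) (by omega)) hcb) ?_
  exact hres

theorem val_smallCode_of_lt {w X n m₂ i m₁ L e x : ℕ} (hw : w < 8)
    (hx : X / 2 ^ (w * i) % 2 ^ w = x) :
    smallCode.val w (fun a => X / 2 ^ (a * w) % 2 ^ w) [i + 1, n, m₂, w, i, m₁, L, e] = x := by
  have h1 : (bin .shr (var 3) (lit 3)).val w (fun a => X / 2 ^ (a * w) % 2 ^ w)
      [i + 1, n, m₂, w, i, m₁, L, e] = 0 := by
    show w >>> (3 % 2 ^ w) = 0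
    interval_cases w <;> rfl
  rw [smallCode, Code.val, h1, if_neg (Nat.not_lt_zero _), ← hx, mul_comm w i]
  rfl

theorem val_smallCode_of_le {w X n m₂ i m₁ L e x : ℕ} (hw : 8 ≤ w) (hi : i < n) (hn : n < 2 ^ w)
    (hm : m₁ < 2 ^ w) (hxm : x ≤ m₁)
    (hx : X / 2 ^ ((Nat.log 2 m₁ + 1) * i) % 2 ^ (Nat.log 2 m₁ + 1) = x) :
    smallCode.val w (fun a => X / 2 ^ (a * w) % 2 ^ w) [i + 1, n, m₂, w, i, m₁, L, e] = x := by
  have hw2 : w * w + w ≤ 2 ^ w := by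
    clear hn hm
    induction w, hw using Nat.le_induction with
    | base => norm_num
    | succ w hw ih => rw [pow_succ]; nlinarith [ih]
  have hwlt : w < 2 ^ w := Nat.lt_two_pow_self
  have hlog : Nat.log 2 m₁ + 1 ≤ w := by
    rcases Nat.eq_zero_or_pos m₁ with rfl | h
    · simp; omega
    · exact Nat.log_lt_of_lt_pow h.ne' hm
  have h0 : (lit 0).val w (fun a => X / 2 ^ (a * w) % 2 ^ w) [i + 1, n, m₂, w, i, m₁, L, e] = 0 :=
    val_lit (by positivity)
  have h1 : 0 < (bin .shr (var 3) (lit 3)).val w (fun a => X / 2 ^ (a * w) % 2 ^ w)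
      [i + 1, n, m₂, w, i, m₁, L, e] := by
    show 0 < w >>> (3 % 2 ^ w)
    rw [Nat.mod_eq_of_lt (by omega), Nat.shiftRight_eq_div_pow]
    omega
  have h2 : (bin .add (msb (var 5)) (lit 1)).val w (fun a => X / 2 ^ (a * w) % 2 ^ w)
      [i + 1, n, m₂, w, i, m₁, L, e] = Nat.log 2 m₁ + 1 :=
    val_add (val_msb (val_var (x := m₁) rfl) hm) (val_lit (by omega)) (by omega)
  have h3 : w * (Nat.log 2 m₁ + 1) ≤ w * w := Nat.mul_le_mul_left _ hlog
  have h4 : i * (Nat.log 2 m₁ + 1) / w ≤ i := by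
    refine Nat.div_le_of_le_mul ?_
    rw [mul_comm w i]
    exact Nat.mul_le_mul_left _ hlog
  have h5 := val_read (w := w) (X := X) (env := [i + 1, n, m₂, w, i, m₁, L, e]) (by omega) rfl
    (fun _ _ => rfl) h0 (val_var (r := 4) (x := i) rfl) h2 h0 h2 (by omega)
    (by simp only [zero_add, add_zero]; omega)
  rw [zero_add, add_zero, mul_comm i, hx, Nat.mod_eq_of_lt (by omega)] at h5
  rw [smallCode, Code.val, h0, if_pos h1, Code.val, h5]

/-- The case a = 2^w is the point: the register holds 0, and the wrapped subtraction still yields a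
- 1. -/
theorem pred_mod {w a : ℕ} (h1 : 1 ≤ a) (h2 : a ≤ 2 ^ w) :
    (2 ^ w - 1 % 2 ^ w + a % 2 ^ w) % 2 ^ w = a - 1 := by
  rcases Nat.eq_zero_or_pos w with rfl | hw
  · simp at h2 ⊢; omega
  · have h3 : 1 < 2 ^ w := Nat.one_lt_two_pow hw.ne'
    rw [Nat.mod_eq_of_lt h3]
    rcases h2.lt_or_eq with h | h
    · rw [Nat.mod_eq_of_lt h, show 2 ^ w - 1 + a = a - 1 + 2 ^ w by omega, Nat.add_mod_right,
        Nat.mod_eq_of_lt (by omega)]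
    · rw [h, Nat.mod_self, add_zero, Nat.mod_eq_of_lt (by omega)]

theorem val_queryCode_of_eq {w n i : ℕ} {M : ℕ → ℕ} (hi : i < n) (hn : n ≤ 2 ^ w) :
    queryCode.val w M [(i + 1) % 2 ^ w, n % 2 ^ w, n % 2 ^ w, w] = i := by
  refine Code.val_bind (v := i) (pred_mod (by omega) (by omega)) ?_
  refine Code.val_bind (v := n - 1) (pred_mod (by omega) hn) ?_
  -- If n = 2^w, the two logarithms are taken of a truncated value. The branch taken ignores them,
  -- so they are left arbitrary.
  have hrest : ∀ y₁ y₂, Code.val w M ([(i + 1) % 2 ^ w, n % 2 ^ w, n % 2 ^ w, w] ++ [i] ++ [n - 1] ++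
      [y₁] ++ [y₂]) (Code.ite (bin .sub (var 1) (lit 1)) (var 5)
        (Code.ite (lit 0) (bin .shr (var 7) (lit 7)) largeCode smallCode)
        (Code.ret (var 4))) = i := by
    intro y₁ y₂
    have h1 : (bin .sub (var 1) (lit 1)).val w M ([(i + 1) % 2 ^ w, n % 2 ^ w, n % 2 ^ w, w] ++
        [i] ++ [n - 1] ++ [y₁] ++ [y₂]) = n - 1 := pred_mod (by omega) hn
    rw [Code.val, h1, val_var (x := n - 1) rfl, if_neg (lt_irrefl _)]
    rfl
  exact Code.val_bind rfl (Code.val_bind rfl (hrest _ _))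

theorem val_queryCode_of_lt {w n m i x : ℕ} {M : ℕ → ℕ} (hi : i < n) (hnm : n < m)
    (hm : m ≤ 2 ^ w)
    (hlarge : 128 ≤ Nat.log 2 (Nat.log 2 n) → largeCode.val w M [i + 1, n, m % 2 ^ w, w, i, m - 1,
      Nat.log 2 n, Nat.log 2 (Nat.log 2 n)] = x)
    (hsmall : Nat.log 2 (Nat.log 2 n) < 128 → smallCode.val w M [i + 1, n, m % 2 ^ w, w, i, m - 1,
      Nat.log 2 n, Nat.log 2 (Nat.log 2 n)] = x) :
    queryCode.val w M [(i + 1) % 2 ^ w, n % 2 ^ w, m % 2 ^ w, w] = x := by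
  have hnw : n < 2 ^ w := hnm.trans_le hm
  have hL : Nat.log 2 n < 2 ^ w := (Nat.log_le_self 2 n).trans_lt hnw
  refine Code.val_bind (v := i) (pred_mod (by omega) (by omega)) ?_
  refine Code.val_bind (v := m - 1) (pred_mod (by omega) hm) ?_
  rw [Nat.mod_eq_of_lt hnw, Nat.mod_eq_of_lt (show i + 1 < 2 ^ w by omega)]
  refine Code.val_bind (v := Nat.log 2 n) (val_msb (val_var (x := n) rfl) hnw) ?_
  refine Code.val_bind (v := Nat.log 2 (Nat.log 2 n))
    (val_msb (val_var (x := Nat.log 2 n) rfl) hL) ?_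
  rw [Code.val]
  have h1 : (bin .sub (var 1) (lit 1)).val w M ([i + 1, n, m % 2 ^ w, w] ++ [i] ++ [m - 1] ++
      [Nat.log 2 n] ++ [Nat.log 2 (Nat.log 2 n)]) = n - 1 := by
    have := pred_mod (w := w) (a := n) (by omega) hnw.le
    rw [Nat.mod_eq_of_lt hnw] at this
    exact this
  rw [h1, val_var (x := m - 1) rfl, if_pos (by omega), Code.val, val_lit (by positivity)]
  have h2 : 0 < (bin .shr (var 7) (lit 7)).val w M ([i + 1, n, m % 2 ^ w, w] ++ [i] ++ [m - 1] ++
      [Nat.log 2 n] ++ [Nat.log 2 (Nat.log 2 n)]) ↔ 128 ≤ Nat.log 2 (Nat.log 2 n) := by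
    show 0 < Nat.log 2 (Nat.log 2 n) >>> (7 % 2 ^ w) ↔ _
    rw [Nat.shiftRight_eq_div_pow]
    -- For w < 3 the literal 7 is truncated, but then n < 4 and the tested value is 0.
    rcases Nat.lt_or_ge w 3 with hw | hw
    · have h3 : n < 2 ^ 2 := hnw.trans_le (Nat.pow_le_pow_right (by norm_num) (by omega))
      have h4 : Nat.log 2 n < 2 := Nat.log_lt_of_lt_pow (by omega) h3
      have h5 : Nat.log 2 (Nat.log 2 n) = 0 := Nat.log_eq_zero_iff.2 (Or.inl h4)
      rw [h5]; simp
    · have h3 : 2 ^ 3 ≤ 2 ^ w := Nat.pow_le_pow_right (by norm_num) hw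
      rw [Nat.mod_eq_of_lt (by omega)]
      omega
  by_cases h : 128 ≤ Nat.log 2 (Nat.log 2 n)
  · rw [if_pos (h2.2 h)]; exact hlarge h
  · rw [if_neg (fun h' => h (h2.1 h'))]; exact hsmall (not_le.1 h)

/-! ### The redundancy and the final assembly -/

/-- The redundancy of the representation of sets of size `n`. -/
def redundancy (n : ℕ) : ℕ :=
  if 128 ≤ Nat.log 2 (Nat.log 2 n) then 50 * n / Nat.log 2 (Nat.log 2 n)
  else n * (2 * Nat.log 2 n + 11)

theorem tendsto_natLog_atTop : Filter.Tendsto (Nat.log 2) Filter.atTop Filter.atTop :=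
  Filter.tendsto_atTop_atTop.2 fun b => ⟨2 ^ b, fun _ ha => Nat.le_log_of_pow_le (by norm_num) ha⟩

/-- Eventually only the first case of `redundancy` applies, and there the iterated logarithm in the
denominator is unbounded. -/
theorem isLittleO_redundancy :
    Asymptotics.IsLittleO Filter.atTop (fun n : ℕ => (redundancy n : ℝ)) fun n : ℕ => (n : ℝ) := by
  rw [Asymptotics.isLittleO_iff]
  intro ε hε
  obtain ⟨N, hN⟩ := exists_nat_gt (50 / ε)
  have hlog : Filter.Tendsto (fun n : ℕ => Nat.log 2 (Nat.log 2 n)) Filter.atTop Filter.atTop :=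
    tendsto_natLog_atTop.comp tendsto_natLog_atTop
  filter_upwards [hlog.eventually_ge_atTop 128, hlog.eventually_ge_atTop N] with n h1 h2
  have he : (0 : ℝ) < Nat.log 2 (Nat.log 2 n) := by
    have : 0 < Nat.log 2 (Nat.log 2 n) := by omega
    exact_mod_cast this
  rw [redundancy, if_pos h1, Real.norm_of_nonneg (by positivity), Real.norm_of_nonneg (by positivity)]
  have h3 : ((50 * n / Nat.log 2 (Nat.log 2 n) : ℕ) : ℝ) ≤
      ((50 * n : ℕ) : ℝ) / (Nat.log 2 (Nat.log 2 n) : ℕ) := Nat.cast_div_le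
  refine h3.trans ?_
  rw [div_le_iff₀ he]
  have h4 : (N : ℝ) ≤ Nat.log 2 (Nat.log 2 n) := by exact_mod_cast h2
  have h5 : 50 ≤ ε * Nat.log 2 (Nat.log 2 n) := by
    rw [div_lt_iff₀ hε] at hN
    nlinarith
  have hn : (0 : ℝ) ≤ n := Nat.cast_nonneg _
  push_cast
  nlinarith

theorem plain_bits_le {n m : ℕ} (hn : 0 < n) (hnm : n < m) :
    (Nat.log 2 (m - 1) + 1) * n ≤ setBits n m + n * (2 * Nat.log 2 n + 3) := by
  have h1 : 2 ^ Nat.log 2 (m - 1) ≤ m :=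
    (Nat.pow_log_le_self 2 (by omega)).trans (Nat.sub_le _ _)
  have h2 : n ≤ 2 ^ (Nat.log 2 n + 1) := (Nat.lt_pow_succ_log_self (by norm_num) _).le
  have h3 : m.choose n ≤ 2 ^ setBits n m := by
    rw [setBits_eq_clog]; exact Nat.le_pow_clog (by norm_num) _
  have h4 : Nat.log 2 (m - 1) * n ≤ setBits n m + (Nat.log 2 n + 1) * (2 * n) := by
    refine (Nat.pow_le_pow_iff_right (a := 2) (by norm_num)).1 ?_
    rw [pow_add, pow_mul, pow_mul]
    calc _ ≤ m ^ n := Nat.pow_le_pow_left h1 n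
      _ ≤ m.choose n * n ^ (2 * n) := pow_le_choose_mul_pow hn hnm.le
      _ ≤ _ := Nat.mul_le_mul h3 (Nat.pow_le_pow_left h2 _)
  nlinarith

theorem setBits_le (n m : ℕ) : setBits n m ≤ m := by
  rw [setBits_eq_clog]
  exact Nat.clog_le_of_le_pow (Nat.choose_le_two_pow _ _)

theorem nth_finset_mem {S : Finset ℕ} {i : ℕ} (hi : i < S.card) : Nat.nth (fun x => x ∈ S) i ∈ S :=
  Nat.nth_mem i fun hf => by
    refine hi.trans_eq ?_
    congr 1
    ext x
    simp

theorem nth_finset_lt {S : Finset ℕ} {i j : ℕ} (hij : i < j) (hj : j < S.card) :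
    Nat.nth (fun x => x ∈ S) i < Nat.nth (fun x => x ∈ S) j := by
  refine Nat.nth_lt_nth' hij fun hf => hj.trans_eq ?_
  congr 1
  ext x
  simp

/-- The representation of a large set. -/
theorem exists_large_representation {w n m : ℕ} {x : ℕ → ℕ}
    (hx : ∀ i j, i < j → j < n → x i < x j) (hxm : ∀ i < n, x i < m)
    (hnm : n < m) (hmw : m ≤ 2 ^ w) (he : 128 ≤ Nat.log 2 (Nat.log 2 n)) :
    ∃ X l : ℕ, X < 2 ^ l ∧ l ≤ setBits n m + redundancy n ∧ ∀ i < n,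
      queryCode.val w (fun a => X / 2 ^ (a * w) % 2 ^ w)
        [(i + 1) % 2 ^ w, n % 2 ^ w, m % 2 ^ w, w] = x i := by
  have s := scale_log (show 100 ≤ Nat.log 2 (Nat.log 2 n) by omega)
  have hred : redundancy n = 50 * n / Nat.log 2 (Nat.log 2 n) := if_pos he
  rw [hred]
  have hb0 : 0 < Nat.log 2 (Nat.log 2 n) := by omega
  have hL := s.L_pos
  -- Together with ℬ(n, m) ≤ m this keeps the string within m + n ≤ 2 · 2^w bits, as the field reads
  -- require.
  have hnm' : 50 * n / Nat.log 2 (Nat.log 2 n) ≤ n := by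
    refine Nat.div_le_of_le_mul (Nat.mul_le_mul_right _ (by omega))
  obtain ⟨k, hk⟩ : ∃ k, k = lowBits (Nat.log 2 (Nat.log 2 n)) n m := ⟨_, rfl⟩
  obtain ⟨dl, hdl⟩ : ∃ dl, dl = 0 ∧ k = 0 ∨ dl = 1 ∧ 0 < k := by
    rcases Nat.eq_zero_or_pos k with h | h
    · exact ⟨0, Or.inl ⟨rfl, h⟩⟩
    · exact ⟨1, Or.inr ⟨rfl, h⟩⟩
  obtain ⟨z, hzdef⟩ : ∃ z, z = highSeq x k dl ((m - 1) / 2 ^ k + 1) n := ⟨_, rfl⟩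
  have hz : StrictMono z := by
    rw [hzdef]
    exact highSeq_strictMono hx hxm (hdl.imp id And.left)
  have hzn : z (numSuper (Nat.log 2 (Nat.log 2 n)) n * 2 ^ (2 * Nat.log 2 (Nat.log 2 n)) *
      (Nat.log 2 (Nat.log 2 n) * Nat.log 2 (Nat.log 2 n))) ≤
      4 * n * Nat.log 2 (Nat.log 2 n) := by
    rw [hzdef]; exact s.highSeq_le x hk (by omega)
  have htot := s.total_le hnm hk hdl hz hzdef
  have hset := setBits_le n m
  obtain ⟨X, hX, hread⟩ := exists_layout (low := fun i => x i % 2 ^ k) (k := k) (n := n) hz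
    (Nat.mul_pos hb0 hb0) (by positivity) hL
    (hzn.trans_lt s.mul_e_lt) s.blockOff_lt (s.superPos_lt hz hzn)
    (fun i _ => Nat.mod_lt _ (by positivity)) s.le_padded
  refine ⟨X, _, hX, htot, fun i hi => ?_⟩
  obtain ⟨hlow, hhigh⟩ := hread i hi
  refine val_queryCode_of_lt hi hnm hmw (fun _ => ?_) (fun h => by omega)
  exact val_largeCode s hnm hmw hi hk hdl (by rw [hzdef, highSeq, if_pos hi]) (hxm i hi)
    (by omega) hlow hhigh

/-- The representation of a small set. -/
theorem exists_small_representation {w n m : ℕ} {x : ℕ → ℕ} (hn : 0 < n)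
    (hxm : ∀ i < n, x i < m)
    (hnm : n < m) (hmw : m ≤ 2 ^ w) (he : Nat.log 2 (Nat.log 2 n) < 128) :
    ∃ X l : ℕ, X < 2 ^ l ∧ l ≤ setBits n m + redundancy n ∧ ∀ i < n,
      queryCode.val w (fun a => X / 2 ^ (a * w) % 2 ^ w)
        [(i + 1) % 2 ^ w, n % 2 ^ w, m % 2 ^ w, w] = x i := by
  have hred : redundancy n = n * (2 * Nat.log 2 n + 11) := if_neg (not_le.2 he)
  rw [hred]
  rcases Nat.lt_or_ge w 8 with hw | hw
  · have hxw : ∀ i < n, x i < 2 ^ w := fun i hi => (hxm i hi).trans_le hmw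
    refine ⟨_, _, packBits_fixed_lt hxw, ?_, fun i hi => val_queryCode_of_lt hi hnm hmw
      (fun h => by omega) fun _ => val_smallCode_of_lt hw (packBits_fixed_read hxw hi)⟩
    have : w * n ≤ n * (2 * Nat.log 2 n + 11) := by
      rw [mul_comm]; exact Nat.mul_le_mul_left _ (by omega)
    omega
  · have hxw : ∀ i < n, x i < 2 ^ (Nat.log 2 (m - 1) + 1) := fun i hi => by
      have h1 := hxm i hi
      have h2 : m - 1 < 2 ^ (Nat.log 2 (m - 1) + 1) := Nat.lt_pow_succ_log_self (by norm_num) _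
      omega
    refine ⟨_, _, packBits_fixed_lt hxw, ?_, fun i hi => val_queryCode_of_lt hi hnm hmw
      (fun h => by omega) fun _ => val_smallCode_of_le hw hi (hnm.trans_le hmw) (by omega)
        (by have := hxm i hi; omega) (packBits_fixed_read hxw hi)⟩
    refine (plain_bits_le hn hnm).trans ?_
    gcongr
    norm_num

theorem mainTheorem8 :
    ∃ (P : WordRAM.Program) (T : ℕ) (f : ℕ → ℕ),
      Asymptotics.IsLittleO Filter.atTop (fun n : ℕ => (f n : ℝ)) (fun n : ℕ => (n : ℝ)) ∧
      ∀ (w n m : ℕ) (S : Finset ℕ),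
        m ≤ 2 ^ w → S ⊆ Finset.range m → S.card = n →
        ∃ D : List Bool,
          D.length ≤ setBits n m + f n ∧
          ∀ i : ℕ, 1 ≤ i → i ≤ n →
            WordRAM.ComputesIn P (WordRAM.memory w D) (WordRAM.queryRegs w i n m) T
              (selectElem S i) := by
  refine ⟨queryProgram, queryProgram.length, redundancy, isLittleO_redundancy, ?_⟩
  intro w n m S hmw hS hn
  suffices h : ∃ X l : ℕ, X < 2 ^ l ∧ l ≤ setBits n m + redundancy n ∧ ∀ i < n,
      queryCode.val w (fun a => X / 2 ^ (a * w) % 2 ^ w)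
        [(i + 1) % 2 ^ w, n % 2 ^ w, m % 2 ^ w, w] = Nat.nth (fun x => x ∈ S) i by
    obtain ⟨X, l, hX, hl, hq⟩ := h
    refine ⟨bitList X l, by rwa [length_bitList], fun i h1 h2 => ?_⟩
    obtain ⟨j, rfl⟩ := Nat.exists_eq_add_of_le' h1
    exact queryProgram_computesIn hX (hq j (by omega))
  have hnm : n ≤ m := by simpa [hn] using Finset.card_le_card hS
  have hx : ∀ i j, i < j → j < n →
      Nat.nth (fun x => x ∈ S) i < Nat.nth (fun x => x ∈ S) j :=
    fun i j hij hj => nth_finset_lt hij (hn ▸ hj)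
  have hxm : ∀ i < n, Nat.nth (fun x => x ∈ S) i < m :=
    fun i hi => Finset.mem_range.1 (hS (nth_finset_mem (hn ▸ hi)))
  rcases Nat.eq_zero_or_pos n with h0 | hpos
  · exact ⟨0, 0, by norm_num, Nat.zero_le _, fun i hi => by omega⟩
  rcases hnm.lt_or_eq with hlt | rfl
  · rcases Nat.lt_or_ge (Nat.log 2 (Nat.log 2 n)) 128 with he | he
    · exact exists_small_representation hpos hxm hlt hmw he
    · exact exists_large_representation hx hxm hlt hmw he
  -- A full set needs no bits: its element of index i, counted from 0, is i itself.
  · refine ⟨0, 0, by norm_num, Nat.zero_le _, fun i hi => ?_⟩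
    rw [val_queryCode_of_eq hi hmw]
    have hSn : S = Finset.range n := Finset.eq_of_subset_of_card_le hS (by simp [hn])
    have hcount : Nat.count (fun x => x ∈ S) i = i := by
      rw [Nat.count_iff_forall]
      intro y hy
      rw [hSn, Finset.mem_range]; omega
    have hi' : i ∈ S := by rw [hSn]; exact Finset.mem_range.2 hi
    have := Nat.nth_count (p := fun x => x ∈ S) hi'
    rw [hcount] at this
    exact this.symm
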